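/- **Theorem 2.1.** Let $T>0$, let $\Phi_0\in(L^2(\mathbb R))^2$, and let $V=V(t,x)$ be a real-valued potential satisfying $$\text{(A)}\quad V\in W^{1,\infty}([0,T];L^\infty(\mathbb R))\cap L^\infty([0,T];W^{2,\infty}(\mathbb R)).$$ For $0<\varepsilon\le 1$ put $\mathcal T^\varepsilon=-i\varepsilon\sigma_1\partial_x+\sigma_3$, where $\sigma_1=\begin{pmatrix}0&1\\1&0\end{pmatrix}$, $\sigma_3=\begin{pmatrix}1&0\\0&-1\end{pmatrix}$, and let $\Phi=\Phi^\varepsilon\in C([0,T];(L^2(\mathbb R))^2)$ be the solution of the Dirac equation $$i\partial_t\Phi=\frac1{\varepsilon^2}\mathcal T^\varepsilon\Phi+V\Phi,\qquad \Phi(0,x)=\Phi_0(x),$$ assumed to satisfy $$\text{(B)}\quad \Phi\in L^\infty([0,T];(H^2(\mathbb R))^2).$$ For a step size $\tau>0$ and $t_n=n\tau$, let $\Phi^n$ be given by the Lie–Trotter splitting $S_1$, $$\Phi^{n+1}=e^{-\frac{i\tau}{\varepsilon^2}\mathcal T^\varepsilon}\,e^{-i\int_{t_n}^{t_{n+1}}V(s,\cdot)\,ds}\,\Phi^n,\qquad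 \Phi^0=\Phi_0,$$ and let $e^n=\Phi(t_n,\cdot)-\Phi^n$. Then there is a constant $C>0$, depending on $T$, $V$ and $\Phi_0$ but not on $\varepsilon$, $\tau$ or $n$, such that for all $\varepsilon\in(0,1]$, all $\tau>0$ and all integers $n\ge0$ with $n\tau\le T$, $$\|e^n\|_{L^2}\le C(\tau+\varepsilon)\qquad\text{and}\qquad \|e^n\|_{L^2}\le C\left(\tau+\frac{\tau}{\varepsilon}\right).$$ Moreover one has, uniformly in $\varepsilon$, $$\|e^n\|_{L^2}\le C\Big(\tau+\max_{0<\delta\le1}\min\{\delta,\tau/\delta\}\Big)\qquad\text{and}\qquad \|e^n\|_{L^2}\le C\sqrt\tau ,$$ and $\tau+\max_{0<\delta\le1}\min\{\delta,\tau/\delta\}\le C\sqrt\tau$ whenever $\tau\le T$. -/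

import Mathlib

open MeasureTheory Set
open scoped ContDiff FourierTransform LineDeriv SchwartzMap

noncomputable section

namespace DiracLie

/-- The values of a two-component spinor: `ℂ²` with its Hermitian norm. -/
abbrev Spinor : Type := EuclideanSpace ℂ (Fin 2)

/-- `(L²(ℝ))²`, with `‖f‖² = ∫ |f₁|² + |f₂|²`. -/
abbrev L2 : Type := Lp Spinor 2 (volume : Measure ℝ)

/-- `L^∞(ℝ)`, real valued. -/
abbrev LInf : Type := Lp ℝ ⊤ (volume : Measure ℝ)

/-- The Pauli matrix `σ₁`, acting on `ℂ²`. -/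
def sigma1 : Spinor →L[ℂ] Spinor := Matrix.toEuclideanCLM (𝕜 := ℂ) !![0, 1; 1, 0]

/-- The Pauli matrix `σ₃`, acting on `ℂ²`. -/
def sigma3 : Spinor →L[ℂ] Spinor := Matrix.toEuclideanCLM (𝕜 := ℂ) !![1, 0; 0, -1]

/-! ### Weak derivatives and Sobolev classes -/

/-- `w` is the weak derivative of `u` on the open set `U ⊆ ℝ`; the functions take values in a
normed space `F`, and integrals are Bochner integrals. -/
def HasWeakDeriv {F : Type*} [NormedAddCommGroup F] [NormedSpace ℝ F]
    (U : Set ℝ) (u w : ℝ → F) : Prop :=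
  LocallyIntegrableOn u U ∧ LocallyIntegrableOn w U ∧
    ∀ φ : ℝ → ℝ, ContDiff ℝ ∞ φ → HasCompactSupport φ → tsupport φ ⊆ U →
      ∫ t, deriv φ t • u t = -∫ t, φ t • w t

/-- `V ∈ W^{2,∞}(ℝ)`, and `V`, `V'`, `V''` are bounded by `K` in `L^∞(ℝ)`. -/
def W2InfBound (V : LInf) (K : ℝ) : Prop :=
  ∃ V₁ V₂ : LInf, HasWeakDeriv univ V V₁ ∧ HasWeakDeriv univ V₁ V₂ ∧
    ‖V‖ ≤ K ∧ ‖V₁‖ ≤ K ∧ ‖V₂‖ ≤ K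

/-- `g = ∂ₓ f` in the sense of tempered distributions, for `f g ∈ (L²(ℝ))²`. -/
def HasSpaceDeriv (f g : L2) : Prop :=
  ∂_{(1 : ℝ)} (f : 𝓢'(ℝ, Spinor)) = (g : 𝓢'(ℝ, Spinor))

/-- `f ∈ (H²(ℝ))²` and `‖f‖_{H²} ≤ K`. -/
def H2Bound (f : L2) (K : ℝ) : Prop :=
  ∃ f₁ f₂ : L2, HasSpaceDeriv f f₁ ∧ HasSpaceDeriv f₁ f₂ ∧
    Real.sqrt (‖f‖ ^ 2 + ‖f₁‖ ^ 2 + ‖f₂‖ ^ 2) ≤ K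

/-- Assumption (A) with `m = 1`, `m_* = 0`:
`V ∈ W^{1,∞}([0,T]; L^∞(ℝ)) ∩ L^∞([0,T]; W^{2,∞}(ℝ))`. -/
structure AssumptionA (T : ℝ) (V : ℝ → LInf) : Prop where
  memLp : MemLp V ⊤ (volume.restrict (Icc 0 T))
  time_deriv : ∃ W : ℝ → LInf, MemLp W ⊤ (volume.restrict (Icc 0 T)) ∧
    HasWeakDeriv (Ioo 0 T) V W
  space_deriv : ∃ K : ℝ, ∀ᵐ t ∂(volume.restrict (Icc 0 T)), W2InfBound (V t) K

/-- Assumption (B) with `m = 1`, `m_* = 0`: `Φ ∈ L^∞([0,T]; (H²(ℝ))²)`. It is only used for `Φ`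
continuous from `[0,T]` to `(L²(ℝ))²`, for which measurability is automatic. -/
def AssumptionB (T : ℝ) (Φ : ℝ → L2) : Prop :=
  ∃ K : ℝ, ∀ᵐ t ∂(volume.restrict (Icc 0 T)), H2Bound (Φ t) K

/-! ### The Dirac equation -/

/-- `g = 𝒯^ε f`, where `𝒯^ε = -i ε σ₁ ∂ₓ + σ₃`. -/
def IsDiracT (ε : ℝ) (f g : L2) : Prop :=
  ∃ f₁ : L2, HasSpaceDeriv f f₁ ∧
    g = (-(Complex.I * (ε : ℂ))) • sigma1.compLp f₁ + sigma3.compLp f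

/-- `Φ ∈ C([0,T]; (L²(ℝ))²)` solves `i ∂ₜ Φ = ε⁻² 𝒯^ε Φ + V Φ` on `(0,T)` with `Φ(0) = Φ₀`: the
time derivative is the weak one, and the equation holds in `(L²(ℝ))²` for almost every `t`. -/
structure IsSolution (ε T : ℝ) (V : ℝ → LInf) (Φ₀ : L2) (Φ : ℝ → L2) : Prop where
  continuousOn : ContinuousOn Φ (Icc 0 T)
  initial : Φ 0 = Φ₀
  equation : ∃ Φ' : ℝ → L2, HasWeakDeriv (Ioo 0 T) Φ Φ' ∧
    ∀ᵐ t ∂(volume.restrict (Ioo 0 T)), ∃ g : L2, IsDiracT ε (Φ t) g ∧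
      Complex.I • Φ' t = ((1 / ε ^ 2 : ℝ) : ℂ) • g + (V t • Φ t : L2)

/-! ### The Lie-Trotter splitting -/

/-- The Fourier symbol of `𝒯^ε`. For `𝓕 f (ξ) = ∫ exp (-2π i x ξ) f(x) dx` the operator `-i ∂ₓ` has
symbol `2π ξ`. -/
def diracSymbol (ε ξ : ℝ) : Spinor →L[ℂ] Spinor :=
  ((2 * Real.pi * ε * ξ : ℝ) : ℂ) • sigma1 + sigma3

lemma sigma1_isSelfAdjoint : IsSelfAdjoint sigma1 := by
  unfold sigma1
  rw [IsSelfAdjoint, ← map_star]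
  congr 1
  ext i j
  fin_cases i <;> fin_cases j <;> simp [Matrix.star_apply]

lemma sigma3_isSelfAdjoint : IsSelfAdjoint sigma3 := by
  unfold sigma3
  rw [IsSelfAdjoint, ← map_star]
  congr 1
  ext i j
  fin_cases i <;> fin_cases j <;> simp [Matrix.star_apply]

lemma isSelfAdjoint_real_smul_add {H : Type*} [NormedAddCommGroup H] [InnerProductSpace ℂ H]
    [CompleteSpace H] {A B : H →L[ℂ] H} (hA : IsSelfAdjoint A) (hB : IsSelfAdjoint B) (r : ℝ) :
    IsSelfAdjoint ((r : ℂ) • A + B) :=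
  (IsSelfAdjoint.smul (Complex.conj_ofReal r) hA).add hB

lemma norm_exp_apply_le {H : Type*} [NormedAddCommGroup H] [InnerProductSpace ℂ H]
    [CompleteSpace H] [Nontrivial H] {A : H →L[ℂ] H} (hA : IsSelfAdjoint A) (s : ℝ) (v : H) :
    ‖NormedSpace.exp ((-(Complex.I * (s : ℂ))) • A) v‖ ≤ 1 * ‖v‖ := by
  let _ : NormedAlgebra ℚ (H →L[ℂ] H) := NormedAlgebra.restrictScalars ℚ ℂ _
  have h : NormedSpace.exp ((-(Complex.I * (s : ℂ))) • A) ∈ unitary (H →L[ℂ] H) := by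
    refine NormedSpace.exp_mem_unitary_of_mem_skewAdjoint ?_
    rw [skewAdjoint.mem_iff, star_smul, hA.star_eq]
    simp
  refine (ContinuousLinearMap.le_opNorm _ v).trans ?_
  gcongr
  exact CStarRing.norm_of_mem_unitary h |>.le

lemma diracSymbol_isSelfAdjoint (ε ξ : ℝ) : IsSelfAdjoint (diracSymbol ε ξ) :=
  isSelfAdjoint_real_smul_add sigma1_isSelfAdjoint sigma3_isSelfAdjoint _

/-- The Fourier symbol of `exp (-i s 𝒯^ε)`. -/
def flowSymbol (ε s ξ : ℝ) : Spinor →L[ℂ] Spinor :=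
  NormedSpace.exp ((-(Complex.I * (s : ℂ))) • diracSymbol ε ξ)

lemma continuous_flowSymbol (ε s : ℝ) : Continuous (flowSymbol ε s) := by
  unfold flowSymbol diracSymbol
  let _ : NormedAlgebra ℚ (Spinor →L[ℂ] Spinor) := NormedAlgebra.restrictScalars ℚ ℂ _
  refine NormedSpace.exp_continuous.comp ?_
  fun_prop

lemma norm_flowSymbol_apply_le (ε s ξ : ℝ) (v : Spinor) : ‖flowSymbol ε s ξ v‖ ≤ 1 * ‖v‖ :=
  norm_exp_apply_le (diracSymbol_isSelfAdjoint ε ξ) s v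

lemma memLp_flowSymbol (ε s : ℝ) (f : L2) :
    MemLp (fun ξ ↦ flowSymbol ε s ξ (f ξ)) 2 (volume : Measure ℝ) := by
  refine MemLp.of_le_mul (Lp.memLp f) ?_ (.of_forall fun ξ ↦ norm_flowSymbol_apply_le ε s ξ _)
  exact (ContinuousLinearMap.id ℂ (Spinor →L[ℂ] Spinor)).aestronglyMeasurable_comp₂
    (continuous_flowSymbol ε s).aestronglyMeasurable (Lp.aestronglyMeasurable f)

/-- The unitary operator `exp (-i s 𝒯^ε)` on `(L²(ℝ))²`, defined as a Fourier multiplier. -/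
def diracFlow (ε s : ℝ) (f : L2) : L2 :=
  𝓕⁻ ((memLp_flowSymbol ε s (𝓕 f)).toLp _)

lemma memLp_phase (W : LInf) (f : L2) :
    MemLp (fun x ↦ Complex.exp (-(Complex.I * ((W x : ℝ) : ℂ))) • f x) 2
      (volume : Measure ℝ) := by
  refine MemLp.of_le_mul (c := 1) (Lp.memLp f) ?_ (.of_forall fun x ↦ ?_)
  · have h : Continuous fun r : ℝ ↦ Complex.exp (-(Complex.I * (r : ℂ))) := by fun_prop
    exact (h.comp_aestronglyMeasurable (Lp.aestronglyMeasurable W)).smul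
      (Lp.aestronglyMeasurable f)
  · rw [norm_smul, Complex.norm_exp]
    simp

/-- Multiplication by `exp (-i W)`, for a real-valued `W ∈ L^∞(ℝ)`. -/
def phase (W : LInf) (f : L2) : L2 := (memLp_phase W f).toLp _

/-- The Lie-Trotter approximations `Φⁿ` with step size `τ`:
`Φⁿ⁺¹ = exp (-i τ 𝒯^ε / ε²) exp (-i ∫_{nτ}^{(n+1)τ} V(s) ds) Φⁿ` and `Φ⁰ = Φ₀`. -/
def lieTrotter (ε τ : ℝ) (V : ℝ → LInf) (Φ₀ : L2) : ℕ → L2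
  | 0 => Φ₀
  | n + 1 => diracFlow ε (τ / ε ^ 2)
      (phase (∫ s in (n * τ)..((n + 1) * τ), V s) (lieTrotter ε τ V Φ₀ n))

end DiracLie

end

noncomputable section

namespace DiracLie

open scoped Topology NNReal
open Filter

/-! ### Lipschitz functions of a real variable -/

section Calculus

variable {E : Type*} [NormedAddCommGroup E] [NormedSpace ℝ E]

/-! Both factors of the splitting are isometries of `L2`, so the global error is at most the sum of
the local errors (`norm_lieTrotter_sub_le`), and each bound reduces to one step from `a` to `b = a +
τ`. Pass to the interaction picture `z(s) = exp(-i A(s)) Φ(s)` with `A(s) = ∫_s^b V` (`twisted`).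
Then `z(b) = Φ(b)`, while applying the free flow to `z(a)` gives exactly one splitting step. The
potential disappears from the equation of `z`, except for the commutator of the phase with `∂ₓ`,
namely `-(i/ε) σ₁ α z` with `α = ∂ₓ A = O(b - s)`. So `z` solves the free equation up to `O(τ/ε)`,
and Duhamel's formula (`norm_sub_flowL_le`) yields a local error `O(τ · τ/ε)`.

For the bound by `τ + ε` the commutator is removed by a normal form. Since `σ₁` and `σ₃`
anticommute, `[σ₃, σ₃σ₁] = 2σ₁`, and adding `(ε/2) σ₃σ₁ γ z` with `γ ≈ α` cancels the term of order
`1/ε` against the large part `ε⁻² σ₃` of the generator (`hasDerivAt_corrected`). The remaining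
residual is `O(τ + ε)`. The correction vanishes at `s = b` and has size `O(ετ)` at `s = a`, so the
local error is `O(τ(τ + ε))`. As `α` need not be differentiable in `L^∞` norm, `γ` is a spatial
difference quotient of `A` with step `ε²`.

The residual contains `∂ₓ Φ`, which must be bounded uniformly in `ε`. The constant-coefficient
operator commutes with translations, so `Φ(· + r) - Φ` solves the Dirac equation with a source of
size `O(|r|)` (`IsStrongSolution.norm_shift_sub_le`), and the singular factor `ε⁻²` never enters a
norm estimate.

For this reason all space derivatives are derivatives of the translation group (`IsDx`). The error
bounds use only the translation modulus of the initial datum, while (B) for positive times serves to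
turn the weak equation into a classical one at almost every time. The uniform bounds follow from
`min ε (τ/ε) ≤ √τ`. -/

lemma sub_le_of_ae_hasDerivAt_le {f : ℝ → ℝ} {K : ℝ≥0} {a b B : ℝ} (hab : a ≤ b)
    (hf : LipschitzOnWith K f (Icc a b))
    (h : ∀ᵐ s, s ∈ Icc a b → ∃ f', HasDerivAt f f' s ∧ f' ≤ B) :
    f b - f a ≤ B * (b - a) := by
  have hac : AbsolutelyContinuousOnInterval f a b := by
    rw [← uIcc_of_le hab] at hf
    exact hf.absolutelyContinuousOnInterval
  rw [← hac.integral_deriv_eq_sub]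
  calc ∫ x in a..b, deriv f x ≤ ∫ _ in a..b, B := by
        refine intervalIntegral.integral_mono_ae_restrict hab hac.intervalIntegrable_deriv
          intervalIntegrable_const ?_
        rw [EventuallyLE, ae_restrict_iff' measurableSet_Icc]
        filter_upwards [h] with s hs hs'
        obtain ⟨f', h1, h2⟩ := hs hs'
        rwa [h1.deriv]
    _ = B * (b - a) := by simp [mul_comm]

/-- A norming functional reduces this to the scalar case. The derivative is part of the hypothesis
because a Lipschitz map into a general Banach space need not be differentiable anywhere. -/
lemma norm_sub_le_of_ae_hasDerivAt {f : ℝ → E} {K : ℝ≥0} {a b B : ℝ} (hab : a ≤ b)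
    (hf : LipschitzOnWith K f (Icc a b))
    (h : ∀ᵐ s, s ∈ Icc a b → ∃ f', HasDerivAt f f' s ∧ ‖f'‖ ≤ B) :
    ‖f b - f a‖ ≤ B * (b - a) := by
  obtain ⟨g, hg1, hg2⟩ := exists_dual_vector'' ℝ (f b - f a)
  have h1 : LipschitzOnWith (‖g‖₊ * K) (fun s ↦ g (f s)) (Icc a b) :=
    g.lipschitz.comp_lipschitzOnWith hf
  have h2 := sub_le_of_ae_hasDerivAt_le (B := B) hab h1 (by
    filter_upwards [h] with s hs hs'
    obtain ⟨f', h3, h4⟩ := hs hs'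
    refine ⟨g f', g.hasFDerivAt.comp_hasDerivAt s h3, ?_⟩
    calc g f' ≤ ‖g f'‖ := le_abs_self _
      _ ≤ ‖g‖ * ‖f'‖ := g.le_opNorm _
      _ ≤ 1 * B := by gcongr
      _ = B := one_mul B)
  rw [← map_sub, hg2] at h2
  simpa using h2

/-- Almost every point of `[a, b]` with `a < b` belongs to a dense subset. -/
lemma Icc_subset_closure_of_ae {p : ℝ → Prop} {a b : ℝ} (hab : a < b)
    (h : ∀ᵐ s, s ∈ Icc a b → p s) : Icc a b ⊆ closure (Icc a b ∩ {s | p s}) := by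
  have hcl : closure (Ioo a b) = Icc a b := closure_Ioo hab.ne
  rw [← hcl]
  refine closure_minimal (fun s hs ↦ ?_) isClosed_closure
  have hd : Dense {s | s ∈ Icc a b → p s} := Measure.dense_of_ae h
  refine mem_closure_iff.2 fun o ho hso ↦ ?_
  obtain ⟨r, hr1, hr2⟩ := hd.inter_open_nonempty (o ∩ Ioo a b) (ho.inter isOpen_Ioo) ⟨s, hso, hs⟩
  have hr : r ∈ Icc a b := Ioo_subset_Icc_self hr1.2
  exact ⟨r, hr1.1, hcl ▸ hr, hr2 hr⟩

/-- Transfers almost-everywhere information to individual times, in particular to `t = 0`, where (B)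
says nothing directly. -/
lemma forall_mem_Icc_of_ae_le {E : Type*} [NormedAddCommGroup E] {f : ℝ → E} {a b B : ℝ} (hab : a < b)
    (hf : ContinuousOn f (Icc a b)) (h : ∀ᵐ s, s ∈ Icc a b → ‖f s‖ ≤ B) :
    ∀ s ∈ Icc a b, ‖f s‖ ≤ B := by
  intro s hs
  have hs' := Icc_subset_closure_of_ae hab h hs
  have hc : ContinuousWithinAt f (Icc a b ∩ {s | ‖f s‖ ≤ B}) s :=
    (hf s hs).mono inter_subset_left
  have := mem_closure_iff_nhdsWithin_neBot.1 hs'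
  exact le_of_tendsto hc.norm (eventually_nhdsWithin_of_forall fun r hr ↦ hr.2)

lemma lipschitzOnWith_intervalIntegral {w : ℝ → E} {B : ℝ≥0} {p q x₀ : ℝ}
    (hw : IntervalIntegrable w volume p q) (hx₀ : x₀ ∈ uIcc p q)
    (hB : ∀ᵐ x, x ∈ uIcc p q → ‖w x‖ ≤ B) :
    LipschitzOnWith B (fun x ↦ ∫ t in x₀..x, w t) (uIcc p q) := by
  refine LipschitzOnWith.of_dist_le_mul fun x hx y hy ↦ ?_
  have hi : ∀ z ∈ uIcc p q, IntervalIntegrable w volume x₀ z := fun z hz ↦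
    hw.mono_set (uIcc_subset_uIcc hx₀ hz)
  rw [dist_eq_norm, intervalIntegral.integral_interval_sub_left (hi x hx) (hi y hy),
    dist_eq_norm, Real.norm_eq_abs]
  refine intervalIntegral.norm_integral_le_of_norm_le_const_ae ?_
  filter_upwards [hB] with z hz hz'
  exact hz (uIcc_subset_uIcc hy hx (uIoc_subset_uIcc hz'))

end Calculus

/-! ### The lemma of du Bois-Reymond -/

section WeakDeriv

variable {F : Type*} [NormedAddCommGroup F] [NormedSpace ℝ F]

lemma exists_Icc_of_isCompact {U K : Set ℝ} (hU : OrdConnected U) {x₀ : ℝ} (hx₀ : x₀ ∈ U)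
    (hK : IsCompact K) (hKU : K ⊆ U) : ∃ p q, p ≤ q ∧ x₀ ∈ Icc p q ∧ Icc p q ⊆ U ∧ K ⊆ Icc p q := by
  have hK' : IsCompact (insert x₀ K) := hK.insert x₀
  have hne : (insert x₀ K).Nonempty := ⟨x₀, mem_insert _ _⟩
  have hsub : insert x₀ K ⊆ U := insert_subset hx₀ hKU
  have h : insert x₀ K ⊆ Icc (sInf (insert x₀ K)) (sSup (insert x₀ K)) := fun x hx ↦
    ⟨csInf_le hK'.bddBelow hx, le_csSup hK'.bddAbove hx⟩
  have hx := h (mem_insert _ _)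
  exact ⟨_, _, hx.1.trans hx.2, hx,
    hU.out (hsub (hK'.sInf_mem hne)) (hsub (hK'.sSup_mem hne)), (subset_insert _ _).trans h⟩

lemma exists_Icc_of_isCompact_isOpen {U K : Set ℝ} (hU : OrdConnected U) (hUo : IsOpen U)
    {x₀ : ℝ} (hx₀ : x₀ ∈ U) (hK : IsCompact K) (hKU : K ⊆ U) :
    ∃ p q, p < q ∧ x₀ ∈ Ioo p q ∧ Icc p q ⊆ U ∧ K ⊆ Ioo p q := by
  obtain ⟨p, q, hpq, hx, hsub, hKs⟩ := exists_Icc_of_isCompact hU hx₀ hK hKU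
  obtain ⟨p', hp', hp''⟩ : ∃ p' ∈ U, p' < p := by
    have := hUo.mem_nhds (hsub (left_mem_Icc.2 hpq))
    obtain ⟨l, hl, hl'⟩ := exists_Ioc_subset_of_mem_nhds this ⟨p - 1, by linarith⟩
    exact ⟨(l + p) / 2, hl' ⟨by linarith, by linarith⟩, by linarith⟩
  obtain ⟨q', hq', hq''⟩ : ∃ q' ∈ U, q < q' := by
    have := hUo.mem_nhds (hsub (right_mem_Icc.2 hpq))
    obtain ⟨l, hl, hl'⟩ := exists_Ico_subset_of_mem_nhds this ⟨q + 1, by linarith⟩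
    exact ⟨(l + q) / 2, hl' ⟨by linarith, by linarith⟩, by linarith⟩
  refine ⟨p', q', by linarith, ⟨hp''.trans_le hx.1, hx.2.trans_lt hq''⟩, hU.out hp' hq', ?_⟩
  exact fun x hx ↦ ⟨hp''.trans_le (hKs hx).1, (hKs hx).2.trans_lt hq''⟩

/-- A test function in an interval with vanishing integral is the derivative of a test function. -/
lemma exists_test_primitive {U : Set ℝ} (hU : OrdConnected U) (hUo : IsOpen U) {x₀ : ℝ}
    (hx₀ : x₀ ∈ U) {ψ : ℝ → ℝ} (hψ : ContDiff ℝ ∞ ψ) (hc : HasCompactSupport ψ)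
    (hs : tsupport ψ ⊆ U) (h0 : ∫ x, ψ x = 0) :
    ∃ φ : ℝ → ℝ, ContDiff ℝ ∞ φ ∧ HasCompactSupport φ ∧ tsupport φ ⊆ U ∧ deriv φ = ψ := by
  obtain ⟨p, q, hpq, -, hsub, hKs⟩ := exists_Icc_of_isCompact_isOpen hU hUo hx₀ hc hs
  have hz : ∀ x, x ∉ Ioo p q → ψ x = 0 := fun x hx ↦
    image_eq_zero_of_notMem_tsupport fun h ↦ hx (hKs h)
  have hd : ∀ x, HasDerivAt (fun x ↦ ∫ t in p..x, ψ t) (ψ x) x := fun x ↦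
    intervalIntegral.integral_hasDerivAt_right (hψ.continuous.intervalIntegrable _ _)
      (hψ.continuous.stronglyMeasurableAtFilter _ _) hψ.continuous.continuousAt
  have hd' : deriv (fun x ↦ ∫ t in p..x, ψ t) = ψ := funext fun x ↦ (hd x).deriv
  have hzero : ∀ x, x ∉ Icc p q → ∫ t in p..x, ψ t = 0 := by
    intro x hx
    rcases lt_or_ge x p with h | h
    · rw [intervalIntegral.integral_symm, neg_eq_zero]
      refine intervalIntegral.integral_zero_ae (.of_forall fun t ht ↦ hz t fun ht' ↦ ?_)
      rw [uIoc_of_le h.le] at ht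
      exact absurd ht.2 (not_le.2 ht'.1)
    · have hqx : q < x := by
        by_contra h'
        exact hx ⟨h, not_lt.1 h'⟩
      rw [intervalIntegral.integral_of_le h, ← h0]
      refine setIntegral_eq_integral_of_forall_compl_eq_zero fun t ht ↦ hz t fun ht' ↦ ht ?_
      exact ⟨ht'.1, ht'.2.le.trans hqx.le⟩
  refine ⟨fun x ↦ ∫ t in p..x, ψ t, ?_, HasCompactSupport.intro isCompact_Icc hzero, ?_, hd'⟩
  · rw [contDiff_infty_iff_deriv, hd']
    exact ⟨fun x ↦ (hd x).differentiableAt, hψ⟩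
  · refine (closure_minimal (fun x hx ↦ ?_) isClosed_Icc).trans hsub
    by_contra h
    exact hx (hzero x h)

variable [CompleteSpace F]

/-- Integration by parts for an `F`-valued primitive: `φ W` minus the primitive of `φ' W + φ w` is
absolutely continuous with derivative zero almost everywhere, hence constant, and `φ` vanishes at
both ends. -/
lemma integral_deriv_smul_primitive {φ : ℝ → ℝ} {w : ℝ → F} {p q x₀ : ℝ} {B : ℝ≥0}
    (hpq : p < q) (hx₀ : x₀ ∈ Ioo p q) (hφ : ContDiff ℝ ∞ φ) (hs : tsupport φ ⊆ Ioo p q)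
    (hw : IntervalIntegrable w volume p q) (hB : ∀ᵐ x, x ∈ Icc p q → ‖w x‖ ≤ B) :
    ∫ x, (deriv φ x • (∫ t in x₀..x, w t) + φ x • w x) = 0 := by
  set W : ℝ → F := fun x ↦ ∫ t in x₀..x, w t
  have hx₀' : x₀ ∈ uIcc p q := by rw [uIcc_of_le hpq.le]; exact Ioo_subset_Icc_self hx₀
  have hWl : LipschitzOnWith B W (uIcc p q) :=
    lipschitzOnWith_intervalIntegral hw hx₀' (by rwa [uIcc_of_le hpq.le])
  have hz : ∀ x, x ∉ Ioo p q → φ x = 0 := fun x hx ↦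
    image_eq_zero_of_notMem_tsupport fun h ↦ hx (hs h)
  have hz' : ∀ x, x ∉ Ioo p q → deriv φ x = 0 := fun x hx ↦
    image_eq_zero_of_notMem_tsupport fun h ↦ hx (hs (tsupport_deriv_subset h))
  set k : ℝ → F := fun x ↦ deriv φ x • W x + φ x • w x
  have hφ' : Continuous (deriv φ) := hφ.continuous_deriv (by simp)
  have hk : IntervalIntegrable k volume p q :=
    ((hφ'.continuousOn.smul hWl.continuousOn).intervalIntegrable).add
      (hw.continuousOn_smul hφ.continuous.continuousOn)
  obtain ⟨C₁, hC₁⟩ := isCompact_uIcc.exists_bound_of_continuousOn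
    (hφ'.continuousOn.smul hWl.continuousOn : ContinuousOn _ (uIcc p q))
  obtain ⟨C₂, hC₂⟩ := (isCompact_uIcc (a := p) (b := q)).exists_bound_of_continuousOn
    hφ.continuous.continuousOn
  have hkB : ∀ᵐ x, x ∈ uIcc p q → ‖k x‖ ≤ (C₁ + C₂ * B).toNNReal := by
    filter_upwards [hB] with x hx hx'
    refine le_trans ?_ (Real.le_coe_toNNReal _)
    refine (norm_add_le _ _).trans (add_le_add (hC₁ x hx') ?_)
    rw [norm_smul]
    have h2 := hC₂ x hx'
    rw [uIcc_of_le hpq.le] at hx'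
    exact mul_le_mul h2 (hx hx') (norm_nonneg _) ((norm_nonneg _).trans h2)
  have hkl := lipschitzOnWith_intervalIntegral hk hx₀' hkB
  have hφl : AbsolutelyContinuousOnInterval φ p q :=
    (hφ.of_le (by simp : (1 : WithTop ℕ∞) ≤ ∞)).contDiffOn.absolutelyContinuousOnInterval
  have hG := (hφl.smul hWl.absolutelyContinuousOnInterval).sub hkl.absolutelyContinuousOnInterval
  obtain ⟨C, hC⟩ := hG.const_of_ae_hasDerivAt_zero (by
    filter_upwards [hw.ae_hasDerivAt_integral, hk.ae_hasDerivAt_integral] with x h1 h2 hx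
    have h3 : HasDerivAt φ (deriv φ x) x := (hφ.differentiable (by simp)).differentiableAt.hasDerivAt
    have h4 := (h3.smul (h1 hx x₀ hx₀')).sub (h2 hx x₀ hx₀')
    have h5 : φ x • w x + deriv φ x • (∫ t in x₀..x, w t) - k x = 0 := by
      simp only [k, W]; abel
    rw [h5] at h4
    exact h4)
  have e1 := hC p left_mem_uIcc
  have e2 := hC q right_mem_uIcc
  simp only [Pi.sub_apply, Pi.smul_apply', hz p (by simp), hz q (by simp), zero_smul, zero_sub]
    at e1 e2
  have hxi : ∀ z ∈ uIcc p q, IntervalIntegrable k volume x₀ z := fun z hz ↦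
    hk.mono_set (uIcc_subset_uIcc hx₀' hz)
  have e3 : ∫ x in p..q, k x = 0 := by
    rw [← intervalIntegral.integral_interval_sub_left (hxi q right_mem_uIcc)
      (hxi p left_mem_uIcc), sub_eq_zero]
    exact neg_injective (e2.trans e1.symm)
  rw [intervalIntegral.integral_of_le hpq.le] at e3
  rw [← e3]
  refine (setIntegral_eq_integral_of_forall_compl_eq_zero fun t ht ↦ ?_).symm
  have ht' : t ∉ Ioo p q := fun h ↦ ht ⟨h.1, h.2.le⟩
  simp [hz t ht', hz' t ht']

/-- A function with a bounded weak derivative agrees with a primitive of the derivative. -/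
lemma HasWeakDeriv.exists_ae_eq {U : Set ℝ} (hU : OrdConnected U) (hUo : IsOpen U) {x₀ : ℝ}
    (hx₀ : x₀ ∈ U) {u w : ℝ → F} {B : ℝ≥0} (h : HasWeakDeriv U u w)
    (hB : ∀ᵐ x, x ∈ U → ‖w x‖ ≤ B) :
    ∃ c, ∀ᵐ x, x ∈ U → u x = c + ∫ t in x₀..x, w t := by
  obtain ⟨hu, hw, htest⟩ := h
  set W : ℝ → F := fun x ↦ ∫ t in x₀..x, w t
  have hwi : ∀ p q, p ≤ q → Icc p q ⊆ U → IntervalIntegrable w volume p q := fun p q hpq hs ↦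
    (intervalIntegrable_iff_integrableOn_Icc_of_le hpq).2
      (hw.integrableOn_compact_subset hs isCompact_Icc)
  have hWc : ContinuousOn W U := by
    intro x hx
    obtain ⟨p, q, hpq, hx₀', hsub, hxs⟩ := exists_Icc_of_isCompact_isOpen hU hUo hx₀
      (isCompact_singleton (x := x)) (singleton_subset_iff.2 hx)
    have h1 := (lipschitzOnWith_intervalIntegral (B := B) (hwi p q hpq.le hsub) (x₀ := x₀)
      (by rw [uIcc_of_le hpq.le]; exact Ioo_subset_Icc_self hx₀')
      (by rw [uIcc_of_le hpq.le]; filter_upwards [hB] with y hy hy' using hy (hsub hy'))).continuousOn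
    rw [uIcc_of_le hpq.le] at h1
    exact (h1.continuousAt (Icc_mem_nhds (hxs rfl).1 (hxs rfl).2)).continuousWithinAt
  have hWl : LocallyIntegrableOn W U := hWc.locallyIntegrableOn hUo.measurableSet
  have hv : LocallyIntegrableOn (fun x ↦ u x - W x) U := hu.sub hWl
  have hint : ∀ {g : ℝ → F} {φ : ℝ → ℝ}, LocallyIntegrableOn g U → Continuous φ →
      HasCompactSupport φ → tsupport φ ⊆ U → Integrable (fun x ↦ φ x • g x) := by
    intro g φ hg hφ hc hs
    have h1 : IntegrableOn (fun x ↦ φ x • g x) (tsupport φ) :=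
      (hg.integrableOn_compact_subset hs hc).continuousOn_smul hφ.continuousOn hc
    refine (integrableOn_iff_integrable_of_support_subset fun x hx ↦ ?_).1 h1
    by_contra hx'
    exact hx (by simp [image_eq_zero_of_notMem_tsupport hx'])
  have hzero : ∀ φ : ℝ → ℝ, ContDiff ℝ ∞ φ → HasCompactSupport φ → tsupport φ ⊆ U →
      ∫ x, deriv φ x • (u x - W x) = 0 := by
    intro φ hφ hc hs
    obtain ⟨p, q, hpq, hx₀', hsub, hKs⟩ := exists_Icc_of_isCompact_isOpen hU hUo hx₀ hc hs
    have h1 := integral_deriv_smul_primitive (B := B) hpq hx₀' hφ hKs (hwi p q hpq.le hsub)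
      (by filter_upwards [hB] with y hy hy' using hy (hsub hy'))
    have hφ' : Continuous (deriv φ) := hφ.continuous_deriv (by simp)
    have hs' : tsupport (deriv φ) ⊆ U := (tsupport_deriv_subset).trans hs
    rw [integral_add (hint hWl hφ' hc.deriv hs') (hint hw hφ.continuous hc hs)] at h1
    simp_rw [smul_sub]
    rw [integral_sub (hint hu hφ' hc.deriv hs') (hint hWl hφ' hc.deriv hs'), htest φ hφ hc hs,
      eq_neg_of_add_eq_zero_left h1]
    simp
  -- The constant is the average of `u - W` against a bump `η₀` around `x₀`. Subtracting a multiple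
  -- of `η₀` gives any test function mean zero, hence makes it the derivative of a test function, on
  -- which `u - W` integrates to zero.
  obtain ⟨η₀, hη1, hη2, hη3, hη4, hη5⟩ :=
    exists_contDiff_tsupport_subset (n := ⊤) (hUo.mem_nhds hx₀)
  have hηpos : 0 < ∫ x, η₀ x := by
    refine hη3.continuous.integral_pos_of_hasCompactSupport_nonneg_nonzero hη2
      (fun x ↦ (hη4 (mem_range_self x)).1) (x := x₀) (by simp [hη5])
  set m := ∫ x, η₀ x
  set c : F := m⁻¹ • ∫ x, η₀ x • (u x - W x)
  refine ⟨c, ?_⟩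
  have hvc : LocallyIntegrableOn (fun x ↦ u x - W x - c) U :=
    hv.sub ((locallyIntegrable_const c : LocallyIntegrable fun _ : ℝ ↦ c).locallyIntegrableOn U)
  have hfin := hUo.ae_eq_zero_of_integral_contDiff_smul_eq_zero hvc (by
    intro ψ hψ hc hs
    set r := m⁻¹ * ∫ x, ψ x
    have hψi : Integrable ψ := hψ.continuous.integrable_of_hasCompactSupport hc
    have hηi : Integrable η₀ := hη3.continuous.integrable_of_hasCompactSupport hη2
    obtain ⟨φ, h1, h2, h3, h4⟩ := exists_test_primitive hU hUo hx₀ (ψ := fun x ↦ ψ x - r * η₀ x)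
      (hψ.sub (contDiff_const.mul hη3)) (hc.sub (hη2.mul_left))
      ((tsupport_sub _ _).trans (union_subset hs ((tsupport_mul_subset_right).trans hη1)))
      (by
        rw [integral_sub hψi (hηi.const_mul r), integral_const_mul]
        simp only [r]
        field_simp
        simp [m])
    have h5 := hzero φ h1 h2 h3
    rw [h4] at h5
    simp_rw [sub_smul (ψ _), mul_smul] at h5
    have h6 : Integrable fun x ↦ r • η₀ x • (u x - W x) := (hint hv hη3.continuous hη2 hη1).smul r
    rw [integral_sub (hint hv hψ.continuous hc hs) h6, integral_smul] at h5
    simp_rw [smul_sub (ψ _) (u _ - W _) c]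
    rw [integral_sub (hint hv hψ.continuous hc hs) (hψi.smul_const c), integral_smul_const]
    rw [← h5]
    simp only [c, r, smul_smul]
    rw [mul_comm])
  filter_upwards [hfin] with x hx hx'
  have := hx hx'
  rw [sub_sub, sub_eq_zero] at this
  rw [this, add_comm]

end WeakDeriv

/-! ### Strongly differentiable families of isometries -/

/-- A product rule that needs only strong, not norm, differentiability of `P`: isometries map the
remainder of `f` to a remainder of the same size, uniformly in `s`. It applies to translations,
phases and the Dirac group alike. -/
lemma hasDerivAt_isometry_apply {E : Type*} [NormedAddCommGroup E] [NormedSpace ℂ E]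
    {P : ℝ → E →ₗᵢ[ℂ] E} {f : ℝ → E} {f' d : E} {s₀ : ℝ} (hf : HasDerivAt f f' s₀)
    (hP : ContinuousAt (fun s ↦ P s f') s₀) (hd : HasDerivAt (fun s ↦ P s (f s₀)) d s₀) :
    HasDerivAt (fun s ↦ P s (f s)) (P s₀ f' + d) s₀ := by
  have h1 : HasDerivAt (fun s ↦ P s (f s - f s₀)) (P s₀ f') s₀ := by
    rw [hasDerivAt_iff_isLittleO] at hf ⊢
    have e : (fun s ↦ P s (f s - f s₀) - P s₀ (f s₀ - f s₀) - (s - s₀) • P s₀ f') =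
        fun s ↦ P s (f s - f s₀ - (s - s₀) • f') + (s - s₀) • (P s f' - P s₀ f') := by
      funext s
      have : P s ((s - s₀) • f') = (s - s₀) • P s f' :=
        (P s).toContinuousLinearMap.map_smul_of_tower _ _
      rw [map_sub (P s) (f s - f s₀), this, sub_self, map_zero, smul_sub]
      abel
    rw [e]
    refine Asymptotics.IsLittleO.add ?_ ?_
    · refine Asymptotics.IsLittleO.of_norm_left ?_
      simpa only [LinearIsometry.norm_map] using hf.norm_left
    · have h0 : Tendsto (fun s ↦ P s f' - P s₀ f') (𝓝 s₀) (𝓝 0) := by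
        simpa using hP.tendsto.sub_const (P s₀ f')
      simpa using (Asymptotics.isBigO_refl (fun s : ℝ ↦ s - s₀) (𝓝 s₀)).smul_isLittleO
        ((Asymptotics.isLittleO_one_iff ℝ).2 h0)
  have h2 := h1.add hd
  refine h2.congr_of_eventuallyEq (.of_forall fun s ↦ ?_)
  simp

/-! ### Translations -/

/-- The translation `f ↦ f (· + h)` on `(L²(ℝ))²`. -/
def shift (h : ℝ) : L2 →ₗᵢ[ℂ] L2 :=
  Lp.compMeasurePreservingₗᵢ ℂ (· + h) (measurePreserving_add_right volume h)

/-- The translation `V ↦ V (· + h)` on `L^∞(ℝ)`. -/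
def shiftInf (h : ℝ) : LInf →ₗᵢ[ℝ] LInf :=
  Lp.compMeasurePreservingₗᵢ ℝ (· + h) (measurePreserving_add_right volume h)

lemma coeFn_shift (h : ℝ) (f : L2) : shift h f =ᵐ[volume] fun x ↦ f (x + h) :=
  Lp.coeFn_compMeasurePreserving f (measurePreserving_add_right volume h)

lemma coeFn_shiftInf (h : ℝ) (V : LInf) : shiftInf h V =ᵐ[volume] fun x ↦ V (x + h) :=
  Lp.coeFn_compMeasurePreserving V (measurePreserving_add_right volume h)

lemma ae_shift {p : ℝ → Prop} (h : ℝ) (hp : ∀ᵐ x, p x) : ∀ᵐ x : ℝ, p (x + h) :=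
  (measurePreserving_add_right volume h).quasiMeasurePreserving.ae hp

lemma shift_zero (f : L2) : shift 0 f = f := by
  refine Lp.ext ?_
  filter_upwards [coeFn_shift 0 f] with x hx
  rw [hx, add_zero]

lemma shiftInf_zero (V : LInf) : shiftInf 0 V = V := by
  refine Lp.ext ?_
  filter_upwards [coeFn_shiftInf 0 V] with x hx
  rw [hx, add_zero]

lemma shift_shift (h k : ℝ) (f : L2) : shift h (shift k f) = shift (h + k) f := by
  refine Lp.ext ?_
  filter_upwards [coeFn_shift (h + k) f, coeFn_shift h (shift k f),
    ae_shift h (coeFn_shift k f)] with x h1 h2 h3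
  rw [h1, h2, h3, add_assoc]

lemma shiftInf_shiftInf (h k : ℝ) (V : LInf) :
    shiftInf h (shiftInf k V) = shiftInf (h + k) V := by
  refine Lp.ext ?_
  filter_upwards [coeFn_shiftInf (h + k) V, coeFn_shiftInf h (shiftInf k V),
    ae_shift h (coeFn_shiftInf k V)] with x h1 h2 h3
  rw [h1, h2, h3, add_assoc]

/-! ### Multiplication operators -/

/-- Multiplication of `L²` by `L^∞`, as a continuous bilinear map. -/
def mulL : LInf →L[ℝ] L2 →L[ℝ] L2 :=
  LinearMap.mkContinuous₂ (LinearMap.mk₂ ℝ (fun (a : LInf) (f : L2) ↦ (a • f : L2))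
    (fun a b f ↦ Lp.smul_add a b f) (fun c a f ↦ Lp.smul_assoc c a f)
    (fun a f g ↦ Lp.add_smul a f g) (fun c a f ↦ (Lp.smul_comm c a f).symm)) 1
    (fun a f ↦ by simpa using Lp.norm_smul_le a f)

lemma coeFn_mulL (a : LInf) (f : L2) : mulL a f =ᵐ[volume] fun x ↦ a x • f x :=
  Lp.coeFn_lpSMul a f

lemma norm_mulL_le (a : LInf) (f : L2) : ‖mulL a f‖ ≤ ‖a‖ * ‖f‖ := Lp.norm_smul_le a f

lemma mulL_smul (a : LInf) (c : ℂ) (f : L2) : mulL a (c • f) = c • mulL a f := by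
  refine Lp.ext ?_
  filter_upwards [coeFn_mulL a f, coeFn_mulL a (c • f), Lp.coeFn_smul c f,
    Lp.coeFn_smul c (mulL a f)] with x h1 h2 h3 h4
  rw [h2, h3, h4, Pi.smul_apply, Pi.smul_apply, h1, smul_comm]

lemma mulL_comm (a b : LInf) (f : L2) : mulL a (mulL b f) = mulL b (mulL a f) := by
  refine Lp.ext ?_
  filter_upwards [coeFn_mulL a f, coeFn_mulL b f, coeFn_mulL a (mulL b f),
    coeFn_mulL b (mulL a f)] with x h1 h2 h3 h4
  rw [h3, h4, h1, h2, smul_comm]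

lemma shift_mulL (h : ℝ) (a : LInf) (f : L2) :
    shift h (mulL a f) = mulL (shiftInf h a) (shift h f) := by
  refine Lp.ext ?_
  filter_upwards [coeFn_shift h (mulL a f), ae_shift h (coeFn_mulL a f), coeFn_shift h f,
    coeFn_shiftInf h a, coeFn_mulL (shiftInf h a) (shift h f)] with x h1 h2 h3 h4 h5
  rw [h1, h2, h5, h3, h4]

lemma norm_ae_le (a : LInf) : ∀ᵐ x, |a x| ≤ ‖a‖ := by
  have h := ae_le_eLpNormEssSup (f := a) (μ := (volume : Measure ℝ))
  have h2 : eLpNormEssSup a (volume : Measure ℝ) ≠ ⊤ := by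
    have := Lp.eLpNorm_ne_top a
    rwa [eLpNorm_exponent_top] at this
  filter_upwards [h] with x hx
  rw [Lp.norm_def, eLpNorm_exponent_top, ← Real.norm_eq_abs, ← toReal_enorm]
  exact ENNReal.toReal_mono h2 hx

lemma norm_linf_le {a : LInf} {C : ℝ} (hC : 0 ≤ C) (h : ∀ᵐ x, |a x| ≤ C) : ‖a‖ ≤ C := by
  rw [Lp.norm_def, eLpNorm_exponent_top]
  refine ENNReal.toReal_le_of_le_ofReal hC ?_
  refine eLpNormEssSup_le_of_ae_bound ?_
  simpa using h

/-! ### Phases -/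

lemma coeFn_phase (W : LInf) (f : L2) :
    phase W f =ᵐ[volume] fun x ↦ Complex.exp (-(Complex.I * ((W x : ℝ) : ℂ))) • f x :=
  MemLp.coeFn_toLp _

lemma norm_exp_neg_I_mul (r : ℝ) : ‖Complex.exp (-(Complex.I * (r : ℂ)))‖ = 1 := by
  rw [Complex.norm_exp]; simp

/-- Multiplication by `exp (-i W)` as a linear isometry. -/
def phaseL (W : LInf) : L2 →ₗᵢ[ℂ] L2 where
  toFun := phase W
  map_add' f g := by
    refine Lp.ext ?_
    filter_upwards [coeFn_phase W f, coeFn_phase W g, coeFn_phase W (f + g), Lp.coeFn_add f g,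
      Lp.coeFn_add (phase W f) (phase W g)] with x h1 h2 h3 h4 h5
    rw [h3, h4, h5, Pi.add_apply, Pi.add_apply, h1, h2, smul_add]
  map_smul' c f := by
    refine Lp.ext ?_
    filter_upwards [coeFn_phase W f, coeFn_phase W (c • f), Lp.coeFn_smul c f,
      Lp.coeFn_smul c (phase W f)] with x h1 h2 h3 h4
    rw [h2, h3, RingHom.id_apply, h4, Pi.smul_apply, Pi.smul_apply, h1, smul_comm]
  norm_map' f := by
    change ‖phase W f‖ = ‖f‖
    rw [Lp.norm_def, Lp.norm_def]
    congr 1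
    refine eLpNorm_congr_norm_ae ?_
    filter_upwards [coeFn_phase W f] with x h1
    rw [h1, norm_smul, norm_exp_neg_I_mul, one_mul]

lemma phaseL_apply (W : LInf) (f : L2) : phaseL W f = phase W f := rfl

lemma coeFn_phaseL (W : LInf) (f : L2) :
    phaseL W f =ᵐ[volume] fun x ↦ Complex.exp (-(Complex.I * ((W x : ℝ) : ℂ))) • f x :=
  coeFn_phase W f

lemma phaseL_zero (f : L2) : phaseL 0 f = f := by
  refine Lp.ext ?_
  filter_upwards [coeFn_phaseL 0 f, Lp.coeFn_zero ℝ ⊤ (volume : Measure ℝ)] with x h1 h2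
  rw [h1, h2]; simp

lemma phaseL_mulL (W a : LInf) (f : L2) : phaseL W (mulL a f) = mulL a (phaseL W f) := by
  refine Lp.ext ?_
  filter_upwards [coeFn_phaseL W f, coeFn_phaseL W (mulL a f), coeFn_mulL a f,
    coeFn_mulL a (phaseL W f)] with x h1 h2 h3 h4
  rw [h2, h3, h4, h1, smul_comm]

lemma shift_phaseL (h : ℝ) (W : LInf) (f : L2) :
    shift h (phaseL W f) = phaseL (shiftInf h W) (shift h f) := by
  refine Lp.ext ?_
  filter_upwards [coeFn_shift h (phaseL W f), ae_shift h (coeFn_phaseL W f), coeFn_shift h f,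
    coeFn_shiftInf h W, coeFn_phaseL (shiftInf h W) (shift h f)] with x h1 h2 h3 h4 h5
  rw [h1, h2, h5, h3, h4]

lemma norm_exp_sub_one_add_le (r : ℝ) :
    ‖Complex.exp (-(Complex.I * (r : ℂ))) - 1 + Complex.I * r‖ ≤ 2 * |r| ^ 2 := by
  have hn : ‖-(Complex.I * (r : ℂ))‖ = |r| := by simp
  -- For small `r` this is the Taylor estimate. For `|r| > 1` the crude bound `2|r|` is already
  -- below `2|r|²`.
  rcases le_or_gt |r| 1 with h | h
  · have := Complex.norm_exp_sub_one_sub_id_le (x := -(Complex.I * (r : ℂ))) (by rwa [hn])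
    rw [hn, sub_neg_eq_add] at this
    nlinarith [sq_nonneg |r|]
  · have h1 : ‖Complex.exp (-(Complex.I * (r : ℂ))) - 1‖ ≤ |r| := by
      have := Real.norm_exp_I_mul_ofReal_sub_one_le (x := -r)
      simpa using this
    refine (norm_add_le _ _).trans ?_
    have h2 : ‖Complex.I * (r : ℂ)‖ = |r| := by simp
    rw [h2]
    nlinarith

lemma norm_phaseL_add_sub_le (W δ : LInf) (f : L2) :
    ‖phaseL (W + δ) f - phaseL W f + Complex.I • mulL δ (phaseL W f)‖ ≤ 2 * ‖δ‖ ^ 2 * ‖f‖ := by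
  refine Lp.norm_le_mul_norm_of_ae_le_mul ?_
  filter_upwards [coeFn_phaseL W f, coeFn_phaseL (W + δ) f, coeFn_mulL δ (phaseL W f),
    Lp.coeFn_add W δ, norm_ae_le δ, Lp.coeFn_sub (phaseL (W + δ) f) (phaseL W f),
    Lp.coeFn_smul Complex.I (mulL δ (phaseL W f)),
    Lp.coeFn_add (phaseL (W + δ) f - phaseL W f) (Complex.I • mulL δ (phaseL W f))]
    with x h1 h2 h3 h4 h5 h6 h7 h8
  rw [h8, Pi.add_apply, h6, h7, Pi.sub_apply, Pi.smul_apply, h3, h2, h1, h4, Pi.add_apply]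
  have e : Complex.exp (-(Complex.I * ((W x + δ x : ℝ) : ℂ))) • f x -
      Complex.exp (-(Complex.I * ((W x : ℝ) : ℂ))) • f x +
      Complex.I • (δ x) • Complex.exp (-(Complex.I * ((W x : ℝ) : ℂ))) • f x =
      (Complex.exp (-(Complex.I * ((W x : ℝ) : ℂ))) *
        (Complex.exp (-(Complex.I * ((δ x : ℝ) : ℂ))) - 1 + Complex.I * δ x)) • f x := by
    rw [← Complex.coe_smul (δ x)]
    simp only [smul_smul, ← sub_smul, ← add_smul]
    congr 1
    push_cast
    rw [mul_add, neg_add, Complex.exp_add]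
    ring
  rw [e, norm_smul, norm_mul, norm_exp_neg_I_mul, one_mul]
  gcongr
  refine (norm_exp_sub_one_add_le _).trans ?_
  gcongr

lemma norm_phaseL_sub_le (W W' : LInf) (f : L2) :
    ‖phaseL W f - phaseL W' f‖ ≤ ‖W - W'‖ * ‖f‖ := by
  refine Lp.norm_le_mul_norm_of_ae_le_mul ?_
  filter_upwards [coeFn_phaseL W f, coeFn_phaseL W' f, Lp.coeFn_sub W W', norm_ae_le (W - W'),
    Lp.coeFn_sub (phaseL W f) (phaseL W' f)] with x h1 h2 h3 h4 h5
  rw [h5, Pi.sub_apply, h1, h2, ← sub_smul, norm_smul]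
  gcongr
  have e : Complex.exp (-(Complex.I * ((W x : ℝ) : ℂ))) -
      Complex.exp (-(Complex.I * ((W' x : ℝ) : ℂ))) =
      Complex.exp (-(Complex.I * ((W' x : ℝ) : ℂ))) *
        (Complex.exp (Complex.I * ((-(W x - W' x) : ℝ) : ℂ)) - 1) := by
    rw [mul_sub, ← Complex.exp_add, mul_one]
    congr 2
    push_cast
    ring
  rw [e, norm_mul, norm_exp_neg_I_mul, one_mul]
  refine Real.norm_exp_I_mul_ofReal_sub_one_le.trans ?_
  rw [norm_neg, Real.norm_eq_abs]
  rwa [h3, Pi.sub_apply] at h4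

/-- The remainder is quadratic in the `L^∞` norm of the increment, so the phase is differentiable in
the potential without any regularity of `f`. -/
lemma hasFDerivAt_phaseL (W : LInf) (f : L2) :
    HasFDerivAt (fun X ↦ phaseL X f)
      (-(((ContinuousLinearMap.restrictScalars ℝ (Complex.I • ContinuousLinearMap.id ℂ L2)).comp
        (mulL.flip (phaseL W f))))) W := by
  rw [hasFDerivAt_iff_isLittleO_nhds_zero]
  have h : (fun δ : LInf ↦ ‖δ‖ ^ 2) =o[𝓝 0] fun δ : LInf ↦ δ :=
    Asymptotics.isLittleO_norm_pow_id one_lt_two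
  refine Asymptotics.IsBigO.trans_isLittleO ?_ h
  refine Asymptotics.IsBigO.of_bound (2 * ‖f‖) (.of_forall fun δ ↦ ?_)
  have := norm_phaseL_add_sub_le W δ f
  simp only [neg_apply, sub_neg_eq_add, norm_pow, norm_norm]
  refine le_trans (le_of_eq ?_) (this.trans (le_of_eq (by ring)))
  rfl

lemma continuous_phaseL_apply (f : L2) : Continuous fun W ↦ phaseL W f :=
  continuous_iff_continuousAt.2 fun W ↦ (hasFDerivAt_phaseL W f).continuousAt

lemma HasDerivAt.phaseL {W : ℝ → LInf} {W' : LInf} {f : ℝ → L2} {f' : L2} {s : ℝ}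
    (hW : HasDerivAt W W' s) (hf : HasDerivAt f f' s) :
    HasDerivAt (fun r ↦ phaseL (W r) (f r))
      (phaseL (W s) f' - Complex.I • mulL W' (phaseL (W s) (f s))) s := by
  rw [sub_eq_add_neg]
  refine hasDerivAt_isometry_apply (P := fun r ↦ DiracLie.phaseL (W r)) hf ?_ ?_
  · exact (continuous_phaseL_apply f').continuousAt.comp hW.continuousAt
  · exact (hasFDerivAt_phaseL (W s) (f s)).comp_hasDerivAt s hW

lemma HasDerivAt.mulL {a : ℝ → LInf} {a' : LInf} {f : ℝ → L2} {f' : L2} {s : ℝ}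
    (ha : HasDerivAt a a' s) (hf : HasDerivAt f f' s) :
    HasDerivAt (fun r ↦ mulL (a r) (f r)) (mulL a' (f s) + mulL (a s) f') s :=
  HasDerivAt.clm_apply (DiracLie.mulL.hasFDerivAt.comp_hasDerivAt s ha) hf

/-! ### Pauli matrices -/

/-- `σ₁` acting on `(L²(ℝ))²`. -/
def pauli1 : L2 →L[ℂ] L2 := sigma1.compLpL 2 volume

/-- `σ₃` acting on `(L²(ℝ))²`. -/
def pauli3 : L2 →L[ℂ] L2 := sigma3.compLpL 2 volume

lemma coeFn_pauli1 (f : L2) : pauli1 f =ᵐ[volume] fun x ↦ sigma1 (f x) :=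
  ContinuousLinearMap.coeFn_compLp _ _

lemma coeFn_pauli3 (f : L2) : pauli3 f =ᵐ[volume] fun x ↦ sigma3 (f x) :=
  ContinuousLinearMap.coeFn_compLp _ _

lemma sigma1_mul_sigma1 : sigma1 * sigma1 = 1 := by
  unfold sigma1
  rw [← map_mul, ← map_one (Matrix.toEuclideanCLM (𝕜 := ℂ) (n := Fin 2))]
  congr 1
  ext i j
  fin_cases i <;> fin_cases j <;> simp

lemma sigma3_mul_sigma3 : sigma3 * sigma3 = 1 := by
  unfold sigma3
  rw [← map_mul, ← map_one (Matrix.toEuclideanCLM (𝕜 := ℂ) (n := Fin 2))]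
  congr 1
  ext i j
  fin_cases i <;> fin_cases j <;> simp

/-- The algebraic source of the `τ + ε` bound: it gives `[σ₃, σ₃σ₁] = 2σ₁`, so a `σ₁` term is a
commutator with `σ₃`. -/
lemma sigma1_mul_sigma3 : sigma1 * sigma3 = -(sigma3 * sigma1) := by
  unfold sigma1 sigma3
  rw [← map_mul (Matrix.toEuclideanCLM (𝕜 := ℂ) (n := Fin 2)),
    ← map_mul (Matrix.toEuclideanCLM (𝕜 := ℂ) (n := Fin 2)), ← map_neg]
  congr 1
  ext i j
  fin_cases i <;> fin_cases j <;> simp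

lemma norm_le_one_of_isSelfAdjoint_of_mul_self {A : Spinor →L[ℂ] Spinor} (h : IsSelfAdjoint A)
    (hA : A * A = 1) : ‖A‖ ≤ 1 := by
  have h1 := CStarRing.norm_star_mul_self (x := A)
  rw [h.star_eq, hA, norm_one] at h1
  nlinarith [norm_nonneg A]

lemma norm_pauli1_le (f : L2) : ‖pauli1 f‖ ≤ ‖f‖ := by
  refine (ContinuousLinearMap.norm_compLp_le sigma1 f).trans ?_
  have := norm_le_one_of_isSelfAdjoint_of_mul_self sigma1_isSelfAdjoint sigma1_mul_sigma1
  nlinarith [norm_nonneg f]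

lemma norm_pauli3_le (f : L2) : ‖pauli3 f‖ ≤ ‖f‖ := by
  refine (ContinuousLinearMap.norm_compLp_le sigma3 f).trans ?_
  have := norm_le_one_of_isSelfAdjoint_of_mul_self sigma3_isSelfAdjoint sigma3_mul_sigma3
  nlinarith [norm_nonneg f]

lemma pauli1_pauli1 (f : L2) : pauli1 (pauli1 f) = f := by
  refine Lp.ext ?_
  filter_upwards [coeFn_pauli1 f, coeFn_pauli1 (pauli1 f)] with x h1 h2
  rw [h2, h1]
  exact DFunLike.congr_fun sigma1_mul_sigma1 (f x)

lemma pauli3_pauli3 (f : L2) : pauli3 (pauli3 f) = f := by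
  refine Lp.ext ?_
  filter_upwards [coeFn_pauli3 f, coeFn_pauli3 (pauli3 f)] with x h1 h2
  rw [h2, h1]
  exact DFunLike.congr_fun sigma3_mul_sigma3 (f x)

lemma pauli1_pauli3 (f : L2) : pauli1 (pauli3 f) = -pauli3 (pauli1 f) := by
  refine Lp.ext ?_
  filter_upwards [coeFn_pauli3 f, coeFn_pauli1 (pauli3 f), coeFn_pauli1 f,
    coeFn_pauli3 (pauli1 f), Lp.coeFn_neg (pauli3 (pauli1 f))] with x h1 h2 h3 h4 h5
  rw [h5, Pi.neg_apply, h4, h3, h2, h1]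
  exact DFunLike.congr_fun sigma1_mul_sigma3 (f x)

lemma shift_pauli1 (h : ℝ) (f : L2) : shift h (pauli1 f) = pauli1 (shift h f) := by
  refine Lp.ext ?_
  filter_upwards [coeFn_shift h (pauli1 f), ae_shift h (coeFn_pauli1 f), coeFn_shift h f,
    coeFn_pauli1 (shift h f)] with x h1 h2 h3 h4
  rw [h1, h2, h4, h3]

lemma shift_pauli3 (h : ℝ) (f : L2) : shift h (pauli3 f) = pauli3 (shift h f) := by
  refine Lp.ext ?_
  filter_upwards [coeFn_shift h (pauli3 f), ae_shift h (coeFn_pauli3 f), coeFn_shift h f,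
    coeFn_pauli3 (shift h f)] with x h1 h2 h3 h4
  rw [h1, h2, h4, h3]

lemma clm_real_smul (A : Spinor →L[ℂ] Spinor) (r : ℝ) (v : Spinor) : A (r • v) = r • A v :=
  A.map_smul_of_tower r v

lemma pauli1_mulL (a : LInf) (f : L2) : pauli1 (mulL a f) = mulL a (pauli1 f) := by
  refine Lp.ext ?_
  filter_upwards [coeFn_pauli1 (mulL a f), coeFn_mulL a f, coeFn_pauli1 f,
    coeFn_mulL a (pauli1 f)] with x h1 h2 h3 h4
  rw [h1, h2, h4, h3, clm_real_smul]

lemma pauli3_mulL (a : LInf) (f : L2) : pauli3 (mulL a f) = mulL a (pauli3 f) := by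
  refine Lp.ext ?_
  filter_upwards [coeFn_pauli3 (mulL a f), coeFn_mulL a f, coeFn_pauli3 f,
    coeFn_mulL a (pauli3 f)] with x h1 h2 h3 h4
  rw [h1, h2, h4, h3, clm_real_smul]

lemma pauli1_phaseL (W : LInf) (f : L2) : pauli1 (phaseL W f) = phaseL W (pauli1 f) := by
  refine Lp.ext ?_
  filter_upwards [coeFn_pauli1 (phaseL W f), coeFn_phaseL W f, coeFn_pauli1 f,
    coeFn_phaseL W (pauli1 f)] with x h1 h2 h3 h4
  rw [h1, h2, h4, h3, map_smul]

lemma pauli3_phaseL (W : LInf) (f : L2) : pauli3 (phaseL W f) = phaseL W (pauli3 f) := by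
  refine Lp.ext ?_
  filter_upwards [coeFn_pauli3 (phaseL W f), coeFn_phaseL W f, coeFn_pauli3 f,
    coeFn_phaseL W (pauli3 f)] with x h1 h2 h3 h4
  rw [h1, h2, h4, h3, map_smul]

/-! ### Dominated convergence in `L²` -/

lemma norm_sq_eq_integral (f : L2) : ‖f‖ ^ 2 = ∫ x, ‖f x‖ ^ 2 := by
  rw [← @inner_self_eq_norm_sq ℂ, L2.inner_def]
  have h : ∀ x, inner ℂ (f x) (f x) = ((‖f x‖ ^ 2 : ℝ) : ℂ) := fun x ↦ by
    rw [inner_self_eq_norm_sq_to_K]; norm_cast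
  simp_rw [h]
  rw [integral_complex_ofReal]
  rfl

lemma tendsto_L2_of_dominated {l : Filter ℝ} [l.IsCountablyGenerated] {Q : ℝ → L2}
    {q : ℝ → ℝ → Spinor} {G g : L2} (hQ : ∀ i, Q i =ᵐ[volume] q i)
    (hb : ∀ᶠ i in l, ∀ᵐ x, ‖q i x‖ ≤ ‖g x‖)
    (hlim : ∀ᵐ x, Tendsto (fun i ↦ q i x) l (𝓝 (G x))) : Tendsto Q l (𝓝 G) := by
  rw [tendsto_iff_norm_sub_tendsto_zero]
  have h1 : Tendsto (fun i ↦ ‖Q i - G‖ ^ 2) l (𝓝 0) := by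
    have e : ∀ i, ‖Q i - G‖ ^ 2 = ∫ x, ‖q i x - G x‖ ^ 2 := fun i ↦ by
      rw [norm_sq_eq_integral]
      refine integral_congr_ae ?_
      filter_upwards [hQ i, Lp.coeFn_sub (Q i) G] with x h1 h2
      rw [h2, Pi.sub_apply, h1]
    simp_rw [e]
    rw [show (0 : ℝ) = ∫ _ : ℝ, (0 : ℝ) by simp]
    refine tendsto_integral_filter_of_dominated_convergence
      (fun x ↦ 2 * ‖g x‖ ^ 2 + 2 * ‖G x‖ ^ 2) (.of_forall fun i ↦ ?_) ?_ ?_ ?_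
    · exact ((((Lp.aestronglyMeasurable (Q i)).congr (hQ i)).sub
        (Lp.aestronglyMeasurable G)).norm.pow 2)
    · filter_upwards [hb] with i hi
      filter_upwards [hi] with x hx
      rw [Real.norm_eq_abs, abs_of_nonneg (by positivity)]
      have := norm_sub_le (q i x) (G x)
      nlinarith [sq_nonneg (‖g x‖ - ‖G x‖), norm_nonneg (q i x - G x), norm_nonneg (G x),
        norm_nonneg (q i x)]
    · exact ((Lp.memLp g).integrable_norm_pow (by simp)).const_mul 2 |>.add
        (((Lp.memLp G).integrable_norm_pow (by simp)).const_mul 2)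
    · filter_upwards [hlim] with x hx
      have := ((hx.sub_const (G x)).norm.pow 2)
      simpa using this
  have h2 := h1.sqrt
  simpa [Real.sqrt_sq] using h2

lemma hasDerivAt_L2_of_dominated {Q : ℝ → L2} {m : ℝ → ℝ → Spinor} {G g : L2}
    (hQ : ∀ h, Q h =ᵐ[volume] m h) (hd : ∀ᵐ x, HasDerivAt (fun h ↦ m h x) (G x) 0)
    (hb : ∀ᵐ x, ∀ h, ‖m h x - m 0 x‖ ≤ |h| * ‖g x‖) : HasDerivAt Q G 0 := by
  rw [hasDerivAt_iff_tendsto_slope_zero]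
  refine tendsto_L2_of_dominated (q := fun h x ↦ h⁻¹ • (m (0 + h) x - m 0 x)) (g := g)
    (fun h ↦ ?_) ?_ ?_
  · filter_upwards [hQ (0 + h), hQ 0, Lp.coeFn_sub (Q (0 + h)) (Q 0),
      Lp.coeFn_smul h⁻¹ (Q (0 + h) - Q 0)] with x h1 h2 h3 h4
    rw [h4, Pi.smul_apply, h3, Pi.sub_apply, h1, h2]
  · refine eventually_nhdsWithin_of_forall fun h hh ↦ ?_
    filter_upwards [hb] with x hx
    rw [zero_add, norm_smul, norm_inv, Real.norm_eq_abs, inv_mul_le_iff₀ (abs_pos.2 hh)]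
    exact hx h
  · filter_upwards [hd] with x hx
    have h1 := hasDerivAt_iff_tendsto_slope_zero.1 hx
    exact h1

/-! ### Fourier symbols -/

lemma ae_eq_of_forall_schwartz {f g : ℝ → Spinor} (hf : LocallyIntegrable f)
    (hg : LocallyIntegrable g) (h : ∀ u : 𝓢(ℝ, ℂ), ∫ x, u x • f x = ∫ x, u x • g x) :
    f =ᵐ[volume] g := by
  refine ae_eq_of_integral_contDiff_smul_eq hf hg fun φ hφ hc ↦ ?_
  have hg₁ : HasCompactSupport (Complex.ofRealCLM ∘ φ) := hc.comp_left rfl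
  have hg₂ : ContDiff ℝ ∞ (Complex.ofRealCLM ∘ φ) := by fun_prop
  simpa using h (hg₁.toSchwartzMap hg₂)

lemma L2_locallyIntegrable (f : L2) : LocallyIntegrable f :=
  (Lp.memLp f).locallyIntegrable (by norm_num)

lemma HasSpaceDeriv.fourier {f g : L2} (h : HasSpaceDeriv f g) :
    (𝓕 g : L2) =ᵐ[volume] fun ξ ↦ ((2 * Real.pi * ξ : ℝ) * Complex.I : ℂ) • (𝓕 f : L2) ξ := by
  refine ae_eq_of_forall_schwartz (L2_locallyIntegrable _) ?_ fun u ↦ ?_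
  · refine (locallyIntegrableOn_univ.1 ?_)
    refine LocallyIntegrableOn.continuousOn_smul isOpen_univ.isLocallyClosed
      ((L2_locallyIntegrable _).locallyIntegrableOn univ) ?_
    fun_prop
  · have h1 : 𝓕 (g : 𝓢'(ℝ, Spinor)) = 𝓕 (∂_{(1 : ℝ)} (f : 𝓢'(ℝ, Spinor))) := by
      rw [show ∂_{(1 : ℝ)} (f : 𝓢'(ℝ, Spinor)) = (g : 𝓢'(ℝ, Spinor)) from h]
    rw [TemperedDistribution.fourier_lineDerivOp_eq, Lp.fourier_toTemperedDistribution_eq,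
      Lp.fourier_toTemperedDistribution_eq] at h1
    have h2 := DFunLike.congr_fun h1 u
    have ht : (fun x : ℝ ↦ ((inner ℝ x (1 : ℝ) : ℝ) : ℂ)).HasTemperateGrowth := by fun_prop
    rw [Lp.toTemperedDistribution_apply] at h2
    rw [h2]
    change (2 * Real.pi * Complex.I) • (TemperedDistribution.smulLeftCLM Spinor _
      (Lp.toTemperedDistribution (𝓕 f : L2))) u = _
    rw [TemperedDistribution.smulLeftCLM_apply_apply, Lp.toTemperedDistribution_apply,
      ← integral_smul]
    refine integral_congr_ae (.of_forall fun x ↦ ?_)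
    simp only [SchwartzMap.smulLeftCLM_apply_apply ht, smul_smul]
    congr 1
    simp
    ring

lemma fourier_compLp {A : Spinor →L[ℂ] Spinor} {f g : L2} (h : g =ᵐ[volume] fun x ↦ A (f x)) :
    (𝓕 g : L2) =ᵐ[volume] fun ξ ↦ A ((𝓕 f : L2) ξ) := by
  have hint : ∀ (f : L2) (u : 𝓢(ℝ, ℂ)), Integrable fun x ↦ u x • f x := fun f u ↦
    memLp_one_iff_integrable.1 ((Lp.memLp f).smul (u.memLp 2 volume))
  have hcomm : ∀ (f : L2) (u : 𝓢(ℝ, ℂ)), ∫ x, u x • A (f x) = A (∫ x, u x • f x) := fun f u ↦ by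
    rw [← A.integral_comp_comm (hint f u)]
    simp
  refine ae_eq_of_forall_schwartz (L2_locallyIntegrable _) ?_ fun u ↦ ?_
  · exact (L2_locallyIntegrable (A.compLp (𝓕 f : L2))).congr (A.coeFn_compLp _)
  · rw [hcomm, ← Lp.toTemperedDistribution_apply, ← Lp.toTemperedDistribution_apply,
      ← Lp.fourier_toTemperedDistribution_eq, ← Lp.fourier_toTemperedDistribution_eq,
      TemperedDistribution.fourier_apply, TemperedDistribution.fourier_apply,
      Lp.toTemperedDistribution_apply, Lp.toTemperedDistribution_apply, ← hcomm]
    refine integral_congr_ae ?_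
    filter_upwards [h] with x hx
    rw [hx]

/-- Both sides are continuous in `f` because the multiplier is unimodular, so the classical formula
for Schwartz functions extends by density. -/
lemma fourier_shift (h : ℝ) (f : L2) :
    (𝓕 (shift h f) : L2) =ᵐ[volume]
      fun ξ ↦ Complex.exp ((2 * Real.pi * ξ : ℝ) * Complex.I * h) • (𝓕 f : L2) ξ := by
  have hn : ∀ ξ : ℝ, ‖Complex.exp ((2 * Real.pi * ξ : ℝ) * Complex.I * h)‖ = 1 := fun ξ ↦ by
    rw [Complex.norm_exp]; simp
  have hm : ∀ g : L2, MemLp (fun ξ ↦ Complex.exp ((2 * Real.pi * ξ : ℝ) * Complex.I * h) • g ξ) 2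
      (volume : Measure ℝ) := fun g ↦ by
    refine MemLp.of_le_mul (c := 1) (Lp.memLp g) ?_ (.of_forall fun ξ ↦ ?_)
    · have hc : Continuous fun ξ : ℝ ↦ Complex.exp ((2 * Real.pi * ξ : ℝ) * Complex.I * h) := by
        fun_prop
      exact hc.aestronglyMeasurable.smul (Lp.aestronglyMeasurable g)
    · rw [norm_smul, hn]
  have key : 𝓕 (shift h f) = (hm (𝓕 f)).toLp _ := by
    refine DenseRange.induction_on
      (p := fun f : L2 ↦ (𝓕 (shift h f) : L2) = (hm (𝓕 f)).toLp _)
      (SchwartzMap.denseRange_toLpCLM (p := 2) ENNReal.ofNat_ne_top) f ?_ ?_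
    · refine isClosed_eq ((Lp.fourierTransformₗᵢ ℝ Spinor).continuous.comp (shift h).continuous) ?_
      refine LipschitzWith.continuous (K := 1) (LipschitzWith.of_dist_le_mul fun f g ↦ ?_)
      rw [dist_eq_norm, dist_eq_norm, ← MemLp.toLp_sub, NNReal.coe_one, one_mul,
        ← Lp.norm_fourier_eq (f - g)]
      refine Lp.norm_le_norm_of_ae_le ?_
      have e : (𝓕 (f - g) : L2) = 𝓕 f - 𝓕 g := (Lp.fourierTransformₗᵢ ℝ Spinor).map_sub f g
      filter_upwards [((hm (𝓕 f)).sub (hm (𝓕 g))).coeFn_toLp, Lp.coeFn_sub (𝓕 f : L2) (𝓕 g)]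
        with ξ h1 h2
      rw [h1, e, h2, Pi.sub_apply, Pi.sub_apply, ← smul_sub, norm_smul, hn, one_mul]
    · intro u
      have e1 : shift h (SchwartzMap.toLpCLM ℝ Spinor 2 volume u) =
          (u.compSubConstCLM ℂ (-h)).toLp 2 := by
        refine Lp.ext ?_
        filter_upwards [coeFn_shift h (u.toLp 2), ae_shift h (u.coeFn_toLp 2 volume),
          (u.compSubConstCLM ℂ (-h)).coeFn_toLp 2 volume] with x h1 h2 h3
        rw [h3]
        refine h1.trans (h2.trans ?_)
        simp
      rw [e1, SchwartzMap.toLp_fourier_eq]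
      refine Lp.ext ?_
      filter_upwards [(hm (𝓕 (u.toLp 2) : L2)).coeFn_toLp,
        (𝓕 (u.compSubConstCLM ℂ (-h))).coeFn_toLp 2 volume,
        (𝓕 u).coeFn_toLp 2 volume] with ξ h1 h2 h3
      rw [h2]
      refine Eq.trans ?_ h1.symm
      rw [SchwartzMap.toLp_fourier_eq, h3, SchwartzMap.fourier_coe, SchwartzMap.fourier_coe]
      have h4 := congrFun (VectorFourier.fourierIntegral_comp_add_right Real.fourierChar volume
        (innerₗ ℝ) (u : ℝ → Spinor) h) ξ
      have h5 : (u.compSubConstCLM ℂ (-h) : ℝ → Spinor) = (u ∘ fun v ↦ v + h) := by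
        funext x; simp
      rw [h5]
      refine h4.trans ?_
      rw [Circle.smul_def, Real.fourierChar_apply]
      congr 2
      simp
      ring
  rw [key]
  exact (hm _).coeFn_toLp

/-! ### The generator of translations -/

/-- `g = ∂ₓ f` as the derivative at `0` of the translation group. -/
def IsDx (f g : L2) : Prop := HasDerivAt (fun h ↦ shift h f) g 0

lemma hasDerivAt_fourier_iff {Q : ℝ → L2} {G : L2} {s : ℝ} :
    HasDerivAt (fun h ↦ (𝓕 (Q h) : L2)) (𝓕 G) s ↔ HasDerivAt Q G s := by
  set 𝓁 : L2 →L[ℝ] L2 :=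
    (Lp.fourierTransformₗᵢ ℝ Spinor).toLinearIsometry.toContinuousLinearMap.restrictScalars ℝ
  set 𝓇 : L2 →L[ℝ] L2 :=
    (Lp.fourierTransformₗᵢ ℝ Spinor).symm.toLinearIsometry.toContinuousLinearMap.restrictScalars ℝ
  constructor
  · intro h
    have h1 := 𝓇.hasFDerivAt.comp_hasDerivAt s h
    have e : ∀ f : L2, 𝓇 (𝓕 f) = f := fun f ↦
      (Lp.fourierTransformₗᵢ ℝ Spinor).symm_apply_apply f
    rw [e] at h1
    exact h1.congr_of_eventuallyEq (.of_forall fun x ↦ (e _).symm)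
  · exact fun h ↦ 𝓁.hasFDerivAt.comp_hasDerivAt s h

lemma hasDerivAt_exp_mul_smul (c : ℂ) (v : Spinor) (s : ℝ) :
    HasDerivAt (fun h : ℝ ↦ Complex.exp (c * h) • v) ((Complex.exp (c * s) * c) • v) s := by
  have h1 : HasDerivAt (fun h : ℝ ↦ c * (h : ℂ)) c s := by
    simpa using (Complex.ofRealCLM.hasDerivAt (x := s)).const_mul c
  exact h1.cexp.smul_const v

/-- On the Fourier side the difference quotients converge pointwise, and `|exp(iθ) - 1| ≤ |θ|`
dominates them by `‖𝓕 g‖`. -/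
lemma isDx_of_fourier {f g : L2}
    (h : (𝓕 g : L2) =ᵐ[volume] fun ξ ↦ ((2 * Real.pi * ξ : ℝ) * Complex.I : ℂ) • (𝓕 f : L2) ξ) :
    IsDx f g := by
  rw [IsDx, ← hasDerivAt_fourier_iff]
  refine hasDerivAt_L2_of_dominated (fun h ↦ fourier_shift h f) (g := 𝓕 g) ?_ ?_
  · filter_upwards [h] with ξ hξ
    have h1 := hasDerivAt_exp_mul_smul ((2 * Real.pi * ξ : ℝ) * Complex.I : ℂ) ((𝓕 f : L2) ξ) 0
    rw [hξ]
    simpa using h1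
  · filter_upwards [h] with ξ hξ r
    rw [hξ, ← sub_smul, norm_smul, norm_smul, ← mul_assoc]
    gcongr
    have h1 := Real.norm_exp_I_mul_ofReal_sub_one_le (x := 2 * Real.pi * ξ * r)
    have e : Complex.I * ((2 * Real.pi * ξ * r : ℝ) : ℂ) =
        ((2 * Real.pi * ξ : ℝ) : ℂ) * Complex.I * r := by push_cast; ring
    rw [e] at h1
    have e2 : ‖((2 * Real.pi * ξ : ℝ) : ℂ) * Complex.I‖ = |2 * Real.pi * ξ| := by
      rw [norm_mul, Complex.norm_I, mul_one, Complex.norm_real, Real.norm_eq_abs]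
    rw [e2, ← abs_mul, mul_comm r]
    simpa using h1

lemma HasSpaceDeriv.isDx {f g : L2} (h : HasSpaceDeriv f g) : IsDx f g :=
  isDx_of_fourier h.fourier

/-- Difference quotients along `1/(n+1)` converge in `L²`, hence almost everywhere along a
subsequence, and there the pointwise limit is explicit. -/
lemma IsDx.fourier {f g : L2} (h : IsDx f g) :
    (𝓕 g : L2) =ᵐ[volume] fun ξ ↦ ((2 * Real.pi * ξ : ℝ) * Complex.I : ℂ) • (𝓕 f : L2) ξ := by
  rw [IsDx, ← hasDerivAt_fourier_iff, hasDerivAt_iff_tendsto_slope_zero] at h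
  set r : ℕ → ℝ := fun n ↦ 1 / ((n : ℝ) + 1)
  have hr : Tendsto r atTop (𝓝[≠] 0) := by
    refine tendsto_nhdsWithin_iff.2 ⟨tendsto_one_div_add_atTop_nhds_zero_nat, .of_forall fun n ↦ ?_⟩
    exact (Nat.one_div_pos_of_nat).ne'
  have h1 := h.comp hr
  obtain ⟨ns, hns, hlim⟩ := (tendstoInMeasure_of_tendsto_Lp h1).exists_seq_tendsto_ae
  have hall : ∀ᵐ ξ, ∀ n : ℕ, ((fun t : ℝ ↦ t⁻¹ • ((𝓕 (shift (0 + t) f) : L2) - 𝓕 (shift 0 f))) ∘ r)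
      n ξ = (r n)⁻¹ • (Complex.exp ((2 * Real.pi * ξ : ℝ) * Complex.I * r n) • (𝓕 f : L2) ξ -
        (𝓕 f : L2) ξ) := by
    refine ae_all_iff.2 fun n ↦ ?_
    filter_upwards [fourier_shift (r n) f,
      Lp.coeFn_smul (r n)⁻¹ ((𝓕 (shift (0 + r n) f) : L2) - 𝓕 (shift 0 f)),
      Lp.coeFn_sub (𝓕 (shift (0 + r n) f) : L2) (𝓕 (shift 0 f))] with ξ h1 h2 h3
    rw [Function.comp_apply, h2, Pi.smul_apply, h3, Pi.sub_apply, zero_add, h1, shift_zero]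
  filter_upwards [hlim, hall] with ξ h2 h3
  have h4 := (hasDerivAt_iff_tendsto_slope_zero.1
    (hasDerivAt_exp_mul_smul ((2 * Real.pi * ξ : ℝ) * Complex.I : ℂ) ((𝓕 f : L2) ξ) 0)).comp
    (hr.comp hns.tendsto_atTop)
  refine tendsto_nhds_unique h2 ?_
  simp only [h3]
  simpa [Function.comp_def] using h4

/-! ### The free Dirac group -/

lemma flowSymbol_eq (ε s ξ : ℝ) :
    flowSymbol ε s ξ = NormedSpace.exp ((s : ℂ) • ((-Complex.I) • diracSymbol ε ξ)) := by
  rw [flowSymbol, smul_smul]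
  congr 2
  ring

lemma flowSymbol_zero (ε ξ : ℝ) : flowSymbol ε 0 ξ = 1 := by
  have e : (0 : ℂ) • ((-Complex.I) • diracSymbol ε ξ) = 0 :=
    ContinuousLinearMap.ext fun v ↦ zero_smul ℂ _
  rw [flowSymbol_eq, Complex.ofReal_zero, e, NormedSpace.exp_zero]

lemma flowSymbol_add (ε s t ξ : ℝ) :
    flowSymbol ε (s + t) ξ = flowSymbol ε s ξ * flowSymbol ε t ξ := by
  let _ : NormedAlgebra ℚ (Spinor →L[ℂ] Spinor) := NormedAlgebra.restrictScalars ℚ ℂ _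
  have e : ((s : ℂ) + t) • ((-Complex.I) • diracSymbol ε ξ) =
    (s : ℂ) • ((-Complex.I) • diracSymbol ε ξ) + (t : ℂ) • ((-Complex.I) • diracSymbol ε ξ) :=
    ContinuousLinearMap.ext fun v ↦ add_smul (s : ℂ) t _
  rw [flowSymbol_eq, flowSymbol_eq, flowSymbol_eq, Complex.ofReal_add, e]
  refine NormedSpace.exp_add_of_commute ?_
  exact ((Commute.refl _).smul_left (s : ℂ)).smul_right (t : ℂ)

lemma norm_flowSymbol_apply (ε s ξ : ℝ) (v : Spinor) : ‖flowSymbol ε s ξ v‖ = ‖v‖ := by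
  refine le_antisymm (by simpa using norm_flowSymbol_apply_le ε s ξ v) ?_
  have h := norm_flowSymbol_apply_le ε (-s) ξ (flowSymbol ε s ξ v)
  have e : flowSymbol ε (-s) ξ (flowSymbol ε s ξ v) = v := by
    have := flowSymbol_add ε (-s) s ξ
    rw [neg_add_cancel, flowSymbol_zero] at this
    exact (DFunLike.congr_fun this v).symm
  rwa [e, one_mul] at h

lemma hasDerivAt_flowSymbol_apply (ε ξ : ℝ) (v : Spinor) (s : ℝ) :
    HasDerivAt (fun r ↦ flowSymbol ε r ξ v)
      (flowSymbol ε s ξ (-(Complex.I • diracSymbol ε ξ v))) s := by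
  have h := HasDerivAt.scomp (h := fun r : ℝ ↦ (r : ℂ)) (h' := 1) s
    (hasDerivAt_exp_smul_const (𝕂 := ℂ) ((-Complex.I) • diracSymbol ε ξ) (s : ℂ))
    Complex.ofRealCLM.hasDerivAt
  rw [one_smul] at h
  have h2 : HasDerivAt (fun r ↦ flowSymbol ε r ξ)
      (flowSymbol ε s ξ * ((-Complex.I) • diracSymbol ε ξ)) s := by
    rw [flowSymbol_eq]
    exact h.congr_of_eventuallyEq (.of_forall fun r ↦ flowSymbol_eq ε r ξ)
  set ev : (Spinor →L[ℂ] Spinor) →L[ℝ] Spinor :=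
    (ContinuousLinearMap.apply ℂ Spinor v).restrictScalars ℝ
  have h3 := ev.hasFDerivAt.comp_hasDerivAt s h2
  convert! h3 using 1
  simp [ev]

lemma norm_flowSymbol_sub_le (ε ξ : ℝ) (v : Spinor) (s : ℝ) :
    ‖flowSymbol ε s ξ v - flowSymbol ε 0 ξ v‖ ≤ |s| * ‖diracSymbol ε ξ v‖ := by
  have h := Convex.norm_image_sub_le_of_norm_hasDerivWithin_le (s := univ)
    (f := fun r ↦ flowSymbol ε r ξ v) (C := ‖diracSymbol ε ξ v‖) (x := 0) (y := s)
    (fun r _ ↦ (hasDerivAt_flowSymbol_apply ε ξ v r).hasDerivWithinAt)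
    (fun r _ ↦ by rw [norm_flowSymbol_apply, norm_neg, norm_smul, Complex.norm_I, one_mul])
    convex_univ (mem_univ _) (mem_univ _)
  rwa [sub_zero, Real.norm_eq_abs, mul_comm] at h

lemma fourier_diracFlow (ε s : ℝ) (f : L2) :
    (𝓕 (diracFlow ε s f) : L2) =ᵐ[volume] fun ξ ↦ flowSymbol ε s ξ ((𝓕 f : L2) ξ) := by
  have h : (𝓕 (diracFlow ε s f) : L2) = (memLp_flowSymbol ε s (𝓕 f)).toLp _ :=
    (Lp.fourierTransformₗᵢ ℝ Spinor).apply_symm_apply _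
  rw [h]
  exact MemLp.coeFn_toLp _

lemma L2_ext_fourier {f g : L2} (h : (𝓕 f : L2) =ᵐ[volume] (𝓕 g : L2)) : f = g :=
  (Lp.fourierTransformₗᵢ ℝ Spinor).injective (Lp.ext h)

lemma fourier_L2_add (f g : L2) : (𝓕 (f + g) : L2) = 𝓕 f + 𝓕 g :=
  (Lp.fourierTransformₗᵢ ℝ Spinor).map_add f g

lemma fourier_L2_smul (c : ℂ) (f : L2) : (𝓕 (c • f) : L2) = c • 𝓕 f :=
  (Lp.fourierTransformₗᵢ ℝ Spinor).map_smul c f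

/-- `exp (-i s 𝒯^ε)` as a linear isometry. -/
def flowL (ε s : ℝ) : L2 →ₗᵢ[ℂ] L2 where
  toFun := diracFlow ε s
  map_add' f g := by
    refine L2_ext_fourier ?_
    rw [fourier_L2_add]
    filter_upwards [fourier_diracFlow ε s f, fourier_diracFlow ε s g,
      fourier_diracFlow ε s (f + g), Lp.coeFn_add (𝓕 f : L2) (𝓕 g),
      Lp.coeFn_add (𝓕 (diracFlow ε s f) : L2) (𝓕 (diracFlow ε s g))] with ξ h1 h2 h3 h4 h5
    rw [h3, h5, Pi.add_apply, h1, h2, fourier_L2_add, h4, Pi.add_apply, map_add]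
  map_smul' c f := by
    refine L2_ext_fourier ?_
    rw [fourier_L2_smul]
    filter_upwards [fourier_diracFlow ε s f, fourier_diracFlow ε s (c • f),
      Lp.coeFn_smul c (𝓕 f : L2), Lp.coeFn_smul c (𝓕 (diracFlow ε s f) : L2)] with ξ h1 h2 h3 h4
    rw [h2, RingHom.id_apply, h4, Pi.smul_apply, h1, fourier_L2_smul, h3, Pi.smul_apply, map_smul]
  norm_map' f := by
    change ‖diracFlow ε s f‖ = ‖f‖
    rw [← Lp.norm_fourier_eq, ← Lp.norm_fourier_eq f, Lp.norm_def, Lp.norm_def]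
    congr 1
    refine eLpNorm_congr_norm_ae ?_
    filter_upwards [fourier_diracFlow ε s f] with ξ h1
    rw [h1, norm_flowSymbol_apply]

lemma flowL_apply (ε s : ℝ) (f : L2) : flowL ε s f = diracFlow ε s f := rfl

lemma fourier_flowL (ε s : ℝ) (f : L2) :
    (𝓕 (flowL ε s f) : L2) =ᵐ[volume] fun ξ ↦ flowSymbol ε s ξ ((𝓕 f : L2) ξ) :=
  fourier_diracFlow ε s f

lemma flowL_add (ε s t : ℝ) (f : L2) : flowL ε (s + t) f = flowL ε s (flowL ε t f) := by
  refine L2_ext_fourier ?_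
  filter_upwards [fourier_flowL ε (s + t) f, fourier_flowL ε t f,
    fourier_flowL ε s (flowL ε t f)] with ξ h1 h2 h3
  rw [h1, h3, h2, flowSymbol_add]
  rfl

lemma flowL_zero (ε : ℝ) (f : L2) : flowL ε 0 f = f := by
  refine L2_ext_fourier ?_
  filter_upwards [fourier_flowL ε 0 f] with ξ h1
  rw [h1, flowSymbol_zero]
  rfl

/-- `𝒯^ε f = -i ε σ₁ g + σ₃ f`, where `g` stands for `∂ₓ f`. -/
def diracT (ε : ℝ) (f g : L2) : L2 := (-(Complex.I * (ε : ℂ))) • pauli1 g + pauli3 f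

lemma IsDx.fourier_diracT {f g : L2} (h : IsDx f g) (ε : ℝ) :
    (𝓕 (-(Complex.I • diracT ε f g)) : L2) =ᵐ[volume]
      fun ξ ↦ -(Complex.I • diracSymbol ε ξ ((𝓕 f : L2) ξ)) := by
  have e : (𝓕 (-(Complex.I • diracT ε f g)) : L2) =
      (-Complex.I) • ((-(Complex.I * (ε : ℂ))) • (𝓕 (pauli1 g) : L2) + 𝓕 (pauli3 f)) := by
    rw [← neg_smul, fourier_L2_smul, diracT, fourier_L2_add, fourier_L2_smul]
  rw [e]
  filter_upwards [h.fourier, fourier_compLp (coeFn_pauli1 g), fourier_compLp (coeFn_pauli3 f),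
    Lp.coeFn_smul (-(Complex.I * (ε : ℂ))) (𝓕 (pauli1 g) : L2),
    Lp.coeFn_add ((-(Complex.I * (ε : ℂ))) • (𝓕 (pauli1 g) : L2)) (𝓕 (pauli3 f)),
    Lp.coeFn_smul (-Complex.I) ((-(Complex.I * (ε : ℂ))) • (𝓕 (pauli1 g) : L2) + 𝓕 (pauli3 f))]
    with ξ h1 h2 h3 h4 h5 h6
  rw [h6, Pi.smul_apply, h5, Pi.add_apply, h4, Pi.smul_apply, h2, h3, h1, map_smul, neg_smul]
  congr 2
  unfold diracSymbol
  rw [add_apply, smul_apply, smul_smul]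
  congr 2
  push_cast
  linear_combination (-(ε : ℂ) * (2 * Real.pi * ξ)) * Complex.I_mul_I

/-- The domination is by the symbol itself: the unitary flow moves a vector `v` by at most `|s|
‖diracSymbol ε ξ v‖`, and this is square integrable because `f` has a derivative in `L²`. -/
lemma IsDx.hasDerivAt_flowL_zero {f g : L2} (h : IsDx f g) (ε : ℝ) :
    HasDerivAt (fun s ↦ flowL ε s f) (-(Complex.I • diracT ε f g)) 0 := by
  rw [← hasDerivAt_fourier_iff]
  refine hasDerivAt_L2_of_dominated (fun s ↦ fourier_flowL ε s f)
    (g := 𝓕 (-(Complex.I • diracT ε f g))) ?_ ?_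
  · filter_upwards [h.fourier_diracT ε] with ξ hξ
    have h1 := hasDerivAt_flowSymbol_apply ε ξ ((𝓕 f : L2) ξ) 0
    rw [flowSymbol_zero] at h1
    rw [hξ]
    exact h1
  · filter_upwards [h.fourier_diracT ε] with ξ hξ s
    rw [hξ, norm_neg, norm_smul, Complex.norm_I, one_mul]
    exact norm_flowSymbol_sub_le ε ξ _ s

lemma IsDx.hasDerivAt_flowL {f g : L2} (h : IsDx f g) (ε s : ℝ) :
    HasDerivAt (fun r ↦ flowL ε r f) (flowL ε s (-(Complex.I • diracT ε f g))) s := by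
  set 𝓁 : L2 →L[ℝ] L2 := (flowL ε s).toContinuousLinearMap.restrictScalars ℝ
  have h0 := h.hasDerivAt_flowL_zero ε
  have h1 : HasDerivAt (fun r ↦ flowL ε (r - s) f) (-(Complex.I • diracT ε f g)) s := by
    have := HasDerivAt.comp_sub_const (f := fun r ↦ flowL ε r f)
      (f' := -(Complex.I • diracT ε f g)) s s (by rwa [sub_self])
    exact this
  have h2 := 𝓁.hasFDerivAt.comp_hasDerivAt s h1
  refine h2.congr_of_eventuallyEq (.of_forall fun r ↦ ?_)
  have := flowL_add ε s (r - s) f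
  rw [add_sub_cancel] at this
  exact this

lemma IsDx.norm_flowL_sub_le {f g : L2} (h : IsDx f g) (ε s t : ℝ) :
    ‖flowL ε s f - flowL ε t f‖ ≤ ‖diracT ε f g‖ * |s - t| := by
  have h := Convex.norm_image_sub_le_of_norm_hasDerivWithin_le (s := univ)
    (f := fun r ↦ flowL ε r f) (C := ‖diracT ε f g‖) (x := t) (y := s)
    (fun r _ ↦ (h.hasDerivAt_flowL ε r).hasDerivWithinAt)
    (fun r _ ↦ by rw [LinearIsometry.norm_map, norm_neg, norm_smul, Complex.norm_I, one_mul])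
    convex_univ (mem_univ _) (mem_univ _)
  rwa [Real.norm_eq_abs] at h

lemma continuous_flowL_apply (ε : ℝ) (f : L2) : Continuous fun s ↦ flowL ε s f := by
  refine continuous_iff_continuousAt.2 fun s ↦ ?_
  have h : Tendsto (fun r ↦ (𝓕 (flowL ε r f) : L2)) (𝓝 s) (𝓝 (𝓕 (flowL ε s f))) := by
    refine tendsto_L2_of_dominated (fun r ↦ fourier_flowL ε r f) (g := 𝓕 f)
      (.of_forall fun r ↦ .of_forall fun ξ ↦ (norm_flowSymbol_apply ε r ξ _).le) ?_
    filter_upwards [fourier_flowL ε s f] with ξ hξ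
    rw [hξ]
    exact (hasDerivAt_flowSymbol_apply ε ξ _ s).continuousAt
  have h2 := ((Lp.fourierTransformₗᵢ ℝ Spinor).symm.continuous.tendsto _).comp h
  have e : ∀ f : L2, (Lp.fourierTransformₗᵢ ℝ Spinor).symm (𝓕 f) = f := fun f ↦
      (Lp.fourierTransformₗᵢ ℝ Spinor).symm_apply_apply f
  simp only [Function.comp_def, e] at h2
  exact h2

/-! ### Calculus with the generator -/

lemma norm_diracT_le {ε : ℝ} (hε : 0 ≤ ε) (f g : L2) : ‖diracT ε f g‖ ≤ ε * ‖g‖ + ‖f‖ := by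
  refine (norm_add_le _ _).trans (add_le_add ?_ (norm_pauli3_le f))
  rw [norm_smul, norm_neg, norm_mul, Complex.norm_I, one_mul, Complex.norm_real,
    Real.norm_of_nonneg hε]
  gcongr
  exact norm_pauli1_le g

lemma IsDx.unique {f g g' : L2} (h : IsDx f g) (h' : IsDx f g') : g = g' :=
  HasDerivAt.unique h h'

lemma IsDx.add {f g f' g' : L2} (h : IsDx f g) (h' : IsDx f' g') : IsDx (f + f') (g + g') := by
  unfold IsDx
  simp only [map_add]
  exact HasDerivAt.add h h'

lemma IsDx.clm {f g : L2} (h : IsDx f g) (A : L2 →L[ℂ] L2)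
    (hA : ∀ r f, shift r (A f) = A (shift r f)) : IsDx (A f) (A g) := by
  unfold IsDx
  simp only [hA]
  exact (A.restrictScalars ℝ).hasFDerivAt.comp_hasDerivAt (0 : ℝ) h

lemma IsDx.smul {f g : L2} (h : IsDx f g) (c : ℂ) : IsDx (c • f) (c • g) :=
  h.clm (c • ContinuousLinearMap.id ℂ L2) fun r f ↦ (shift r).map_smul c f

lemma IsDx.pauli1 {f g : L2} (h : IsDx f g) : IsDx (pauli1 f) (pauli1 g) :=
  h.clm _ shift_pauli1

lemma IsDx.pauli3 {f g : L2} (h : IsDx f g) : IsDx (pauli3 f) (pauli3 g) :=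
  h.clm _ shift_pauli3

lemma IsDx.shift {f g : L2} (h : IsDx f g) (r : ℝ) : IsDx (shift r f) (shift r g) :=
  h.clm (DiracLie.shift r).toContinuousLinearMap fun k f ↦ by
    change DiracLie.shift k (DiracLie.shift r f) = DiracLie.shift r (DiracLie.shift k f)
    rw [shift_shift, shift_shift, add_comm]

/-- Translation acts on each factor separately, so this is the product rule at `0`. It requires the
translates of `W` to be differentiable in `L^∞` norm. -/
lemma IsDx.phaseL {W W' : LInf} (hW : HasDerivAt (fun h ↦ shiftInf h W) W' 0) {f g : L2}
    (h : IsDx f g) : IsDx (phaseL W f) (phaseL W g - Complex.I • mulL W' (phaseL W f)) := by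
  have h1 := HasDerivAt.phaseL hW h
  simp only [shiftInf_zero, shift_zero] at h1
  unfold IsDx
  simpa only [shift_phaseL] using h1

lemma IsDx.mulL {a a' : LInf} (ha : HasDerivAt (fun h ↦ shiftInf h a) a' 0) {f g : L2}
    (h : IsDx f g) : IsDx (mulL a f) (mulL a' f + mulL a g) := by
  have h1 := HasDerivAt.mulL ha h
  simp only [shiftInf_zero, shift_zero] at h1
  unfold IsDx
  simpa only [shift_mulL] using h1

lemma IsDx.norm_le {f g : L2} (h : IsDx f g) {K : ℝ} (hK : 0 ≤ K)
    (hf : ∀ r, ‖DiracLie.shift r f - f‖ ≤ K * |r|) : ‖g‖ ≤ K := by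
  have h1 := HasDerivAt.le_of_lip' h hK (.of_forall fun r ↦ by
    have := hf r
    simpa [shift_zero] using this)
  exact h1

lemma IsDx.norm_shift_sub_le {f g : L2} (h : IsDx f g) (r : ℝ) :
    ‖DiracLie.shift r f - f‖ ≤ ‖g‖ * |r| := by
  have hd : ∀ s, HasDerivAt (fun r ↦ DiracLie.shift r f) (DiracLie.shift s g) s := fun s ↦ by
    have h1 : HasDerivAt (fun r ↦ DiracLie.shift (r - s) (DiracLie.shift s f))
        (DiracLie.shift s g) s := by
      have := HasDerivAt.comp_sub_const (f := fun r ↦ DiracLie.shift r (DiracLie.shift s f))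
        (f' := DiracLie.shift s g) s s (by rw [sub_self]; exact h.shift s)
      exact this
    simpa only [shift_shift, sub_add_cancel] using h1
  have h1 := Convex.norm_image_sub_le_of_norm_hasDerivWithin_le (s := univ)
    (f := fun r ↦ DiracLie.shift r f) (C := ‖g‖) (x := 0) (y := r)
    (fun r _ ↦ (hd r).hasDerivWithinAt)
    (fun r _ ↦ by rw [LinearIsometry.norm_map]) convex_univ (mem_univ _) (mem_univ _)
  simpa [shift_zero] using h1

/-! ### Potentials with two bounded derivatives -/

lemma LInf_intervalIntegrable (w : LInf) (x y : ℝ) : IntervalIntegrable w volume x y :=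
  intervalIntegrable_iff.2
    (((Lp.memLp w).locallyIntegrable (by simp)).integrableOn_isCompact isCompact_uIcc
      |>.mono_set uIoc_subset_uIcc)

lemma HasWeakDeriv.exists_primitive {u w : LInf} (h : HasWeakDeriv univ u w) :
    ∃ v : ℝ → ℝ, (∀ᵐ x, u x = v x) ∧ ∀ x y, v y - v x = ∫ t in x..y, w t := by
  obtain ⟨c, hc⟩ := h.exists_ae_eq (B := ‖w‖.toNNReal) ordConnected_univ isOpen_univ (mem_univ 0)
    (by
      filter_upwards [norm_ae_le w] with x hx _
      rw [Real.coe_toNNReal _ (norm_nonneg _)]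
      exact hx)
  refine ⟨fun x ↦ c + ∫ t in (0 : ℝ)..x, w t, by filter_upwards [hc] with x hx using hx trivial,
    fun x y ↦ ?_⟩
  rw [add_sub_add_left_eq_sub, intervalIntegral.integral_interval_sub_left
    (LInf_intervalIntegrable w _ _) (LInf_intervalIntegrable w _ _)]

lemma abs_integral_LInf_le {w : LInf} {K : ℝ} (hw : ‖w‖ ≤ K) (x y : ℝ) :
    |∫ t in x..y, w t| ≤ K * |y - x| := by
  have := intervalIntegral.norm_integral_le_of_norm_le_const_ae (f := w) (C := K) (a := x) (b := y)
    (by filter_upwards [norm_ae_le w] with t ht _ using ht.trans hw)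
  simpa using this

/-- Records the regularity of `V` through translations only, a form that survives integration in
time. A bounded `V''` makes `V'` Lipschitz, which yields a quadratic Taylor remainder uniformly in
`x`. -/
lemma W2InfBound.exists_deriv {V : LInf} {K : ℝ} (h : W2InfBound V K) :
    ∃ W : LInf, ‖V‖ ≤ K ∧ ‖W‖ ≤ K ∧ (∀ r, ‖shiftInf r V - V‖ ≤ K * |r|) ∧
      (∀ r, ‖shiftInf r V - V - r • W‖ ≤ K * r ^ 2) ∧ ∀ r, ‖shiftInf r W - W‖ ≤ K * |r| := by
  obtain ⟨V₁, V₂, h1, h2, hV, hV₁, hV₂⟩ := h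
  have hK : 0 ≤ K := (norm_nonneg V).trans hV
  obtain ⟨v, hv, hvi⟩ := h1.exists_primitive
  obtain ⟨w, hw, hwi⟩ := h2.exists_primitive
  have hwl : ∀ x y, |w y - w x| ≤ K * |y - x| := fun x y ↦ by
    rw [hwi]; exact abs_integral_LInf_le hV₂ x y
  refine ⟨V₁, hV, hV₁, fun r ↦ ?_, fun r ↦ ?_, fun r ↦ ?_⟩
  · refine norm_linf_le (by positivity) ?_
    filter_upwards [coeFn_shiftInf r V, Lp.coeFn_sub (shiftInf r V) V, hv, ae_shift r hv]
      with x e1 e2 e3 e4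
    rw [e2, Pi.sub_apply, e1, e3, e4, hvi]
    simpa using abs_integral_LInf_le hV₁ x (x + r)
  · refine norm_linf_le (by positivity) ?_
    filter_upwards [coeFn_shiftInf r V, Lp.coeFn_sub (shiftInf r V) V, hv, ae_shift r hv,
      Lp.coeFn_sub (shiftInf r V - V) (r • V₁), Lp.coeFn_smul r V₁, hw] with x e1 e2 e3 e4 e5 e6 e7
    rw [e5, Pi.sub_apply, e2, Pi.sub_apply, e1, e3, e4, hvi, e6, Pi.smul_apply, e7, smul_eq_mul]
    have e8 : ∫ t in x..x + r, V₁ t = ∫ t in x..x + r, w t :=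
      intervalIntegral.integral_congr_ae (by filter_upwards [hw] with t ht _ using ht)
    have hwc : Continuous w :=
      (LipschitzWith.of_dist_le_mul (K := K.toNNReal) fun y x ↦ by
        rw [Real.dist_eq, Real.dist_eq, Real.coe_toNNReal _ hK]; exact hwl x y).continuous
    have e9 : (∫ t in x..x + r, V₁ t) - r * w x = ∫ t in x..x + r, (w t - w x) := by
      rw [e8, intervalIntegral.integral_sub (hwc.intervalIntegrable _ _)
        intervalIntegrable_const]
      simp
    rw [e9]
    have e10 := intervalIntegral.norm_integral_le_of_norm_le_const (f := fun t ↦ w t - w x)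
      (C := K * |r|) (a := x) (b := x + r) (fun t ht ↦ by
        refine (hwl x t).trans (mul_le_mul_of_nonneg_left ?_ hK)
        have := abs_sub_left_of_mem_uIcc (uIoc_subset_uIcc ht)
        rwa [add_sub_cancel_left] at this)
    rw [Real.norm_eq_abs, add_sub_cancel_left] at e10
    refine e10.trans (le_of_eq ?_)
    rw [mul_assoc, ← sq, sq_abs]
  · refine norm_linf_le (by positivity) ?_
    filter_upwards [coeFn_shiftInf r V₁, Lp.coeFn_sub (shiftInf r V₁) V₁, hw, ae_shift r hw]
      with x e1 e2 e3 e4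
    rw [e2, Pi.sub_apply, e1, e3, e4]
    simpa using hwl x (x + r)

/-- `W r` is the derivative in space of the potential `V r`, with bounds that are uniform in the
time `r ∈ [0, T]`. -/
structure IsPotential (T K : ℝ) (V W : ℝ → LInf) : Prop where
  nonneg : 0 ≤ K
  integrable : IntegrableOn V (Icc 0 T)
  integrable_deriv : IntegrableOn W (Icc 0 T)
  bound : ∀ᵐ r, r ∈ Icc 0 T → ‖V r‖ ≤ K ∧ ‖W r‖ ≤ K ∧
    (∀ h, ‖shiftInf h (V r) - V r‖ ≤ K * |h|) ∧
    (∀ h, ‖shiftInf h (V r) - V r - h • W r‖ ≤ K * h ^ 2) ∧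
    ∀ h, ‖shiftInf h (W r) - W r‖ ≤ K * |h|

lemma AssumptionA.exists_isPotential {T : ℝ} (hT : 0 < T) {V : ℝ → LInf} (hA : AssumptionA T V) :
    ∃ K W, IsPotential T K V W := by
  classical
  obtain ⟨K, hK⟩ := hA.space_deriv
  have hV : IntegrableOn V (Icc 0 T) := hA.memLp.integrable (by simp)
  set W : ℝ → LInf := fun r ↦
    if h : W2InfBound (V r) K then h.exists_deriv.choose else 0
  have hW : ∀ᵐ r ∂(volume.restrict (Icc 0 T)), ‖V r‖ ≤ K ∧ ‖W r‖ ≤ K ∧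
      (∀ h, ‖shiftInf h (V r) - V r‖ ≤ K * |h|) ∧
      (∀ h, ‖shiftInf h (V r) - V r - h • W r‖ ≤ K * h ^ 2) ∧
      ∀ h, ‖shiftInf h (W r) - W r‖ ≤ K * |h| := by
    filter_upwards [hK] with r hr
    have := hr.exists_deriv.choose_spec
    simp only [W, dif_pos hr]
    exact this
  have hK0 : 0 ≤ K := by
    have : NeBot (ae (volume.restrict (Icc 0 T))) := by
      rw [ae_neBot, Ne, Measure.restrict_eq_zero, Real.volume_Icc]
      simpa using hT
    obtain ⟨r, hr⟩ := hW.exists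
    exact (norm_nonneg _).trans hr.1
  refine ⟨K, W, hK0, hV, ?_, (ae_restrict_iff' measurableSet_Icc).1 hW⟩
  -- `W` was picked by choice separately at each time. It is measurable as the limit of difference
  -- quotients of `V`, thanks to the quadratic remainder.
  have hmeas : AEStronglyMeasurable W (volume.restrict (Icc 0 T)) := by
    refine aestronglyMeasurable_of_tendsto_ae (u := atTop)
      (f := fun (n : ℕ) r ↦ ((n : ℝ) + 1) • (shiftInf (1 / ((n : ℝ) + 1)) (V r) - V r))
      (fun n ↦ ?_) ?_
    · exact (((shiftInf _).continuous.comp_aestronglyMeasurable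
        hV.aestronglyMeasurable).sub hV.aestronglyMeasurable).const_smul ((n : ℝ) + 1)
    · filter_upwards [hW] with r hr
      rw [tendsto_iff_norm_sub_tendsto_zero]
      refine squeeze_zero (fun _ ↦ norm_nonneg _) (fun n ↦ ?_)
        (by simpa only [mul_zero] using tendsto_one_div_add_atTop_nhds_zero_nat.const_mul K)
      have hn : (0 : ℝ) < (n : ℝ) + 1 := by positivity
      have h1 := hr.2.2.2.1 (1 / ((n : ℝ) + 1))
      have e : ((n : ℝ) + 1) • (shiftInf (1 / ((n : ℝ) + 1)) (V r) - V r) - W r =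
          ((n : ℝ) + 1) • (shiftInf (1 / ((n : ℝ) + 1)) (V r) - V r -
            (1 / ((n : ℝ) + 1)) • W r) := by
        rw [smul_sub _ _ ((1 / ((n : ℝ) + 1)) • W r), smul_smul, mul_one_div_cancel hn.ne',
          one_smul]
      rw [e, norm_smul, Real.norm_of_nonneg hn.le]
      calc ((n : ℝ) + 1) * _ ≤ ((n : ℝ) + 1) * (K * (1 / ((n : ℝ) + 1)) ^ 2) := by gcongr
        _ = K * (1 / ((n : ℝ) + 1)) := by field_simp
  exact Integrable.of_bound hmeas K (by filter_upwards [hW] with r hr using hr.2.1)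

namespace IsPotential

variable {T K : ℝ} {V W : ℝ → LInf}

lemma intervalIntegrable (h : IsPotential T K V W) {s b : ℝ} (hs : s ∈ Icc 0 T)
    (hb : b ∈ Icc 0 T) : IntervalIntegrable V volume s b :=
  intervalIntegrable_iff.2 (h.integrable.mono_set
    (uIoc_subset_uIcc.trans (OrdConnected.uIcc_subset ordConnected_Icc hs hb)))

lemma intervalIntegrable_deriv (h : IsPotential T K V W) {s b : ℝ} (hs : s ∈ Icc 0 T)
    (hb : b ∈ Icc 0 T) : IntervalIntegrable W volume s b :=
  intervalIntegrable_iff.2 (h.integrable_deriv.mono_set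
    (uIoc_subset_uIcc.trans (OrdConnected.uIcc_subset ordConnected_Icc hs hb)))

lemma ae_uIoc (_h : IsPotential T K V W) {p : ℝ → Prop} (hp : ∀ᵐ r, r ∈ Icc 0 T → p r) {s b : ℝ}
    (hs : s ∈ Icc 0 T) (hb : b ∈ Icc 0 T) : ∀ᵐ r, r ∈ uIoc s b → p r := by
  filter_upwards [hp] with r hr hr'
  exact hr (OrdConnected.uIcc_subset ordConnected_Icc hs hb (uIoc_subset_uIcc hr'))

lemma norm_integral_deriv_le (h : IsPotential T K V W) {s b : ℝ} (hs : s ∈ Icc 0 T)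
    (hb : b ∈ Icc 0 T) : ‖∫ r in s..b, W r‖ ≤ K * |b - s| :=
  intervalIntegral.norm_integral_le_of_norm_le_const_ae
    (h.ae_uIoc (by filter_upwards [h.bound] with r hr hr' using (hr hr').2.1) hs hb)

lemma norm_integral_le (h : IsPotential T K V W) {s b : ℝ} (hs : s ∈ Icc 0 T)
    (hb : b ∈ Icc 0 T) : ‖∫ r in s..b, V r‖ ≤ K * |b - s| :=
  intervalIntegral.norm_integral_le_of_norm_le_const_ae
    (h.ae_uIoc (by filter_upwards [h.bound] with r hr hr' using (hr hr').1) hs hb)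

lemma shiftInf_integral (_h : IsPotential T K V W) {U : ℝ → LInf} {s b : ℝ}
    (hU : IntervalIntegrable U volume s b) (δ : ℝ) :
    shiftInf δ (∫ r in s..b, U r) = ∫ r in s..b, shiftInf δ (U r) :=
  ((shiftInf δ).toContinuousLinearMap.intervalIntegral_comp_comm hU).symm

lemma intervalIntegrable_shiftInf (_h : IsPotential T K V W) {U : ℝ → LInf} {s b : ℝ}
    (hU : IntervalIntegrable U volume s b) (δ : ℝ) :
    IntervalIntegrable (fun r ↦ shiftInf δ (U r)) volume s b :=
  ⟨(shiftInf δ).toContinuousLinearMap.integrable_comp hU.1,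
    (shiftInf δ).toContinuousLinearMap.integrable_comp hU.2⟩

lemma norm_shiftInf_integral_sub_le (h : IsPotential T K V W) {s b : ℝ} (hs : s ∈ Icc 0 T)
    (hb : b ∈ Icc 0 T) (δ : ℝ) :
    ‖shiftInf δ (∫ r in s..b, V r) - ∫ r in s..b, V r‖ ≤ K * |δ| * |b - s| := by
  have hV := h.intervalIntegrable hs hb
  rw [h.shiftInf_integral hV, ← intervalIntegral.integral_sub (h.intervalIntegrable_shiftInf hV δ) hV]
  exact intervalIntegral.norm_integral_le_of_norm_le_const_ae
    (h.ae_uIoc (by filter_upwards [h.bound] with r hr hr' using (hr hr').2.2.1 δ) hs hb)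

lemma norm_shiftInf_integral_deriv_sub_le (h : IsPotential T K V W) {s b : ℝ} (hs : s ∈ Icc 0 T)
    (hb : b ∈ Icc 0 T) (δ : ℝ) :
    ‖shiftInf δ (∫ r in s..b, W r) - ∫ r in s..b, W r‖ ≤ K * |δ| * |b - s| := by
  have hW := h.intervalIntegrable_deriv hs hb
  rw [h.shiftInf_integral hW, ← intervalIntegral.integral_sub (h.intervalIntegrable_shiftInf hW δ) hW]
  exact intervalIntegral.norm_integral_le_of_norm_le_const_ae
    (h.ae_uIoc (by filter_upwards [h.bound] with r hr hr' using (hr hr').2.2.2.2 δ) hs hb)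

lemma norm_shiftInf_integral_sub_sub_le (h : IsPotential T K V W) {s b : ℝ} (hs : s ∈ Icc 0 T)
    (hb : b ∈ Icc 0 T) (δ : ℝ) :
    ‖shiftInf δ (∫ r in s..b, V r) - (∫ r in s..b, V r) - δ • ∫ r in s..b, W r‖ ≤
      K * δ ^ 2 * |b - s| := by
  have hV := h.intervalIntegrable hs hb
  have hW := h.intervalIntegrable_deriv hs hb
  have hV' := h.intervalIntegrable_shiftInf hV δ
  have hW' : IntervalIntegrable (fun r ↦ δ • W r) volume s b := hW.smul δ
  rw [h.shiftInf_integral hV, ← intervalIntegral.integral_sub hV' hV,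
    ← intervalIntegral.integral_smul, ← intervalIntegral.integral_sub (hV'.sub hV) hW']
  exact intervalIntegral.norm_integral_le_of_norm_le_const_ae
    (h.ae_uIoc (by filter_upwards [h.bound] with r hr hr' using (hr hr').2.2.2.1 δ) hs hb)

/-- This is where the second space derivative of `V` enters: the quadratic remainder gives
differentiability in `L^∞` norm, which a bounded first derivative alone would not. -/
lemma hasDerivAt_shiftInf_integral (h : IsPotential T K V W) {s b : ℝ} (hs : s ∈ Icc 0 T)
    (hb : b ∈ Icc 0 T) :
    HasDerivAt (fun δ ↦ shiftInf δ (∫ r in s..b, V r)) (∫ r in s..b, W r) 0 := by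
  rw [hasDerivAt_iff_isLittleO_nhds_zero]
  have h2 : (fun δ : ℝ ↦ δ ^ 2) =o[𝓝 0] fun δ : ℝ ↦ δ := Asymptotics.isLittleO_pow_id one_lt_two
  refine Asymptotics.IsBigO.trans_isLittleO ?_ h2
  refine Asymptotics.IsBigO.of_bound (K * |b - s|) (.of_forall fun δ ↦ ?_)
  rw [zero_add, shiftInf_zero]
  refine (h.norm_shiftInf_integral_sub_sub_le hs hb δ).trans (le_of_eq ?_)
  rw [Real.norm_of_nonneg (sq_nonneg δ)]
  ring

lemma ae_hasDerivAt_integral (h : IsPotential T K V W) (hT : 0 ≤ T) :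
    ∀ᵐ s, s ∈ Icc 0 T → ∀ b ∈ Icc 0 T, HasDerivAt (fun s ↦ ∫ r in s..b, V r) (-(V s)) s := by
  have hV := h.intervalIntegrable (left_mem_Icc.2 hT) (right_mem_Icc.2 hT)
  filter_upwards [hV.ae_hasDerivAt_integral] with s hs hs' b hb
  rw [uIcc_of_le hT] at hs
  have := (hs hs' b hb).neg
  refine this.congr_of_eventuallyEq (.of_forall fun x ↦ ?_)
  exact intervalIntegral.integral_symm _ _

end IsPotential

/-! ### Growth estimates -/

/-- The Lipschitz function `f` is differentiable almost everywhere. Its difference quotients are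
dominated by those of `D`, whose limit has norm at most `B`. -/
lemma sub_le_of_ae_comparison {f : ℝ → ℝ} {C : ℝ≥0} {a b B : ℝ} (hab : a ≤ b)
    (hf : LipschitzOnWith C f (Icc a b))
    (h : ∀ᵐ s, s ∈ Icc a b → ∃ (D : ℝ → L2) (r : L2), HasDerivAt D r 0 ∧ D 0 = 0 ∧ ‖r‖ ≤ B ∧
      ∀ k, |f (s + k) - f s| ≤ ‖D k‖) :
    f b - f a ≤ B * (b - a) := by
  have hac : AbsolutelyContinuousOnInterval f a b := by
    rw [← uIcc_of_le hab] at hf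
    exact hf.absolutelyContinuousOnInterval
  refine sub_le_of_ae_hasDerivAt_le hab hf ?_
  filter_upwards [h, hac.ae_differentiableAt] with s hs hd hs'
  obtain ⟨D, r, hD, hD0, hr, hk⟩ := hs hs'
  have hfd := (hd (by rwa [uIcc_of_le hab])).hasDerivAt
  refine ⟨_, hfd, (le_abs_self _).trans (le_trans ?_ hr)⟩
  have h1 := (hasDerivAt_iff_tendsto_slope_zero.1 hfd).norm
  have h2 := (hasDerivAt_iff_tendsto_slope_zero.1 hD).norm
  refine le_of_tendsto_of_tendsto h1 h2 (.of_forall fun k ↦ ?_)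
  simp only [norm_smul, zero_add, hD0, sub_zero]
  gcongr
  exact hk k

lemma real_smul_L2 (r : ℝ) (f : L2) : r • f = (r : ℂ) • f := by
  refine Lp.ext ?_
  filter_upwards [Lp.coeFn_smul r f, Lp.coeFn_smul (r : ℂ) f] with x h1 h2
  rw [h1, h2, Pi.smul_apply, Pi.smul_apply, Complex.coe_smul]

lemma hasDerivAt_flowL_phaseL {f g : L2} (h : IsDx f g) (ε c : ℝ) (V : LInf) :
    HasDerivAt (fun k : ℝ ↦ flowL ε (c * k) (phaseL (k • V) f))
      (-(Complex.I • (c : ℂ) • diracT ε f g) - Complex.I • mulL V f) 0 := by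
  have hV : HasDerivAt (fun k : ℝ ↦ k • V) V 0 := by
    simpa using (hasDerivAt_id (0 : ℝ)).smul_const V
  have h1 : HasDerivAt (fun k : ℝ ↦ phaseL (k • V) f) (-(Complex.I • mulL V f)) 0 := by
    have := HasDerivAt.phaseL hV (hasDerivAt_const (0 : ℝ) f)
    simpa [phaseL_zero] using this
  have h2 : HasDerivAt (fun k : ℝ ↦ flowL ε (c * k) f) (c • (-(Complex.I • diracT ε f g))) 0 := by
    have h3 : HasDerivAt (fun k : ℝ ↦ c * k) c 0 := by
      simpa using (hasDerivAt_id (0 : ℝ)).const_mul c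
    have h4 : HasDerivAt (fun s ↦ flowL ε s f) (-(Complex.I • diracT ε f g)) (c * 0) := by
      rw [mul_zero]; exact h.hasDerivAt_flowL_zero ε
    exact h4.scomp (0 : ℝ) h3
  have h5 := hasDerivAt_isometry_apply (P := fun k : ℝ ↦ flowL ε (c * k)) h1
    ((continuous_flowL_apply ε _).comp (continuous_const_mul c)).continuousAt
    (by rw [zero_smul, phaseL_zero]; exact h2)
  convert! h5 using 1
  rw [mul_zero, flowL_zero, real_smul_L2]
  module

/-- The norm of an approximate solution of the Dirac equation grows at most like its residual. -/
lemma norm_le_of_residual {ε c T B : ℝ} {V : ℝ → LInf} {w : ℝ → L2} {C : ℝ≥0}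
    (hw : LipschitzOnWith C w (Icc 0 T))
    (h : ∀ᵐ s, s ∈ Icc 0 T → ∃ g r, IsDx (w s) g ∧ ‖r‖ ≤ B ∧ HasDerivAt w
      (-(Complex.I • (c : ℂ) • diracT ε (w s) g) - Complex.I • mulL (V s) (w s) + r) s)
    {t : ℝ} (ht : t ∈ Icc 0 T) : ‖w t‖ ≤ ‖w 0‖ + B * t := by
  have hsub : Icc 0 t ⊆ Icc 0 T := Icc_subset_Icc_right ht.2
  have h1 := sub_le_of_ae_comparison (f := fun s ↦ ‖w s‖) (B := B) (C := 1 * C) ht.1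
    (lipschitzWith_one_norm.comp_lipschitzOnWith (hw.mono hsub)) ?_
  · simp only [sub_zero] at h1
    linarith
  · filter_upwards [h] with s hs hs'
    obtain ⟨g, r, hg, hr, hd⟩ := hs (hsub hs')
    -- The comparison curve `flowL ε (c * k) (phaseL (k • V s) (w s))` has constant norm and the
    -- derivative of an exact solution at `k = 0`. The difference therefore has derivative `r`, and
    -- no integration by parts is needed.
    refine ⟨fun k ↦ w (s + k) - flowL ε (c * k) (phaseL (k • V s) (w s)), r, ?_, ?_, hr, fun k ↦ ?_⟩
    · have h2 : HasDerivAt (fun k ↦ w (s + k)) _ 0 :=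
        HasDerivAt.comp_const_add (f := w) s 0 (by rw [add_zero]; exact hd)
      convert! h2.sub (hasDerivAt_flowL_phaseL hg ε c (V s)) using 1
      abel
    · simp [flowL_zero, phaseL_zero]
    · have e : ‖w s‖ = ‖flowL ε (c * k) (phaseL (k • V s) (w s))‖ := by
        rw [LinearIsometry.norm_map, LinearIsometry.norm_map]
      rw [e]
      exact abs_norm_sub_norm_le _ _

/-- Comparison of an approximate solution of the free Dirac equation with the free Dirac group. -/
lemma norm_sub_flowL_le {ε c a b B L : ℝ} (hab : a < b) {y : ℝ → L2} {C : ℝ≥0}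
    (hy : LipschitzOnWith C y (Icc a b))
    (h : ∀ᵐ s, s ∈ Icc a b → ∃ g r, IsDx (y s) g ∧ ‖diracT ε (y s) g‖ ≤ L ∧ ‖r‖ ≤ B ∧
      HasDerivAt y (-(Complex.I • (c : ℂ) • diracT ε (y s) g) + r) s) :
    ‖y b - flowL ε (c * (b - a)) (y a)‖ ≤ B * (b - a) := by
  -- Duhamel's formula: after undoing the free flow, only the residual is left in the derivative.
  set f : ℝ → L2 := fun s ↦ flowL ε (-(c * s)) (y s)
  have hfc : ContinuousOn f (Icc a b) := by
    intro s hs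
    refine tendsto_iff_norm_sub_tendsto_zero.2 ?_
    have h1 : Tendsto (fun r ↦ ‖y r - y s‖ + ‖flowL ε (-(c * r)) (y s) - flowL ε (-(c * s)) (y s)‖)
        (𝓝[Icc a b] s) (𝓝 0) := by
      have h2 := tendsto_iff_norm_sub_tendsto_zero.1 (hy.continuousOn s hs)
      have h3 : Continuous fun r : ℝ ↦ flowL ε (-(c * r)) (y s) :=
        (continuous_flowL_apply ε (y s)).comp (by fun_prop)
      have h4 := tendsto_iff_norm_sub_tendsto_zero.1 
        ((h3.continuousAt (x := s)).continuousWithinAt (s := Icc a b))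
      simpa using h2.add h4
    refine squeeze_zero (fun _ ↦ norm_nonneg _) (fun r ↦ ?_) h1
    have e : f r - f s = flowL ε (-(c * r)) (y r - y s) +
        (flowL ε (-(c * r)) (y s) - flowL ε (-(c * s)) (y s)) := by
      rw [map_sub]; simp only [f]; abel
    rw [e]
    refine (norm_add_le _ _).trans ?_
    rw [LinearIsometry.norm_map]
  -- The bound `L` on the generator is available on a dense set of times, and continuity of `f`
  -- extends the Lipschitz estimate. Only the finiteness of `L` matters, as it does not appear in
  -- the conclusion.
  have hlip : LipschitzOnWith (C + (L * |c|).toNNReal) f (Icc a b) := by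
    have hcl := Icc_subset_closure_of_ae hab h
    refine (LipschitzOnWith.closure (hfc.mono ?_) ?_).mono hcl
    · exact closure_minimal inter_subset_left isClosed_Icc
    · refine LipschitzOnWith.of_dist_le_mul fun s hs r hr ↦ ?_
      obtain ⟨g, -, hg, hL, -, -⟩ := hr.2
      have e : f s - f r = flowL ε (-(c * s)) (y s - y r) +
          (flowL ε (-(c * s)) (y r) - flowL ε (-(c * r)) (y r)) := by
        rw [map_sub]; simp only [f]; abel
      rw [dist_eq_norm, e, NNReal.coe_add, add_mul]
      refine (norm_add_le _ _).trans (add_le_add ?_ ?_)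
      · rw [LinearIsometry.norm_map, ← dist_eq_norm]
        exact hy.dist_le_mul _ hs.1 _ hr.1
      · refine (hg.norm_flowL_sub_le ε _ _).trans ?_
        have h5 : |-(c * s) - -(c * r)| = |c| * dist s r := by
          rw [Real.dist_eq, ← abs_mul, ← abs_neg]; congr 1; ring
        rw [h5, ← mul_assoc]
        gcongr
        refine le_trans ?_ (Real.le_coe_toNNReal _)
        gcongr
  have hd := norm_sub_le_of_ae_hasDerivAt (B := B) hab.le hlip (by
    filter_upwards [h] with s hs hs'
    obtain ⟨g, r, hg, -, hr, hd⟩ := hs hs'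
    refine ⟨flowL ε (-(c * s)) r, ?_, by rwa [LinearIsometry.norm_map]⟩
    have h2 : HasDerivAt (fun k : ℝ ↦ flowL ε (-(c * k)) (y s))
        ((-c) • flowL ε (-(c * s)) (-(Complex.I • diracT ε (y s) g))) s := by
      have h3 : HasDerivAt (fun k : ℝ ↦ -(c * k)) (-c) s := by
        have h6 := ((hasDerivAt_id s).const_mul c).neg
        rw [mul_one] at h6
        exact h6
      exact (hg.hasDerivAt_flowL ε (-(c * s))).scomp s h3
    have h5 := hasDerivAt_isometry_apply (P := fun k : ℝ ↦ flowL ε (-(c * k))) hd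
      ((continuous_flowL_apply ε _).comp (by fun_prop)).continuousAt h2
    convert! h5 using 1
    rw [real_smul_L2, ← map_smul, ← map_add]
    congr 1
    push_cast
    module)
  have e : y b - flowL ε (c * (b - a)) (y a) = flowL ε (c * b) (f b - f a) := by
    rw [map_sub]
    simp only [f]
    rw [← flowL_add, ← flowL_add, add_neg_cancel, flowL_zero]
    congr 3
    ring
  rwa [e, LinearIsometry.norm_map]

/-! ### Strong solutions -/

/-- Solutions of the Dirac equation that are Lipschitz continuous in time and satisfy the equation
classically at almost all times. -/
structure IsStrongSolution (ε T : ℝ) (V : ℝ → LInf) (Φ : ℝ → L2) : Prop where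
  lipschitz : ∃ C : ℝ≥0, LipschitzOnWith C Φ (Icc 0 T)
  equation : ∀ᵐ s, s ∈ Icc 0 T → ∃ g, IsDx (Φ s) g ∧ HasDerivAt Φ
    (-(Complex.I • ((1 / ε ^ 2 : ℝ) : ℂ) • diracT ε (Φ s) g) - Complex.I • mulL (V s) (Φ s)) s

lemma H2Bound.exists_isDx {f : L2} {K : ℝ} (h : H2Bound f K) : ∃ g, IsDx f g ∧ ‖g‖ ≤ K := by
  obtain ⟨f₁, f₂, h1, -, h2⟩ := h
  refine ⟨f₁, h1.isDx, le_trans ?_ h2⟩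
  refine Real.le_sqrt_of_sq_le ?_
  nlinarith [sq_nonneg ‖f‖, sq_nonneg ‖f₂‖]

/-- The bound on `∂ₓ Φ` from (B) makes the right side of the equation bounded in time. Thus `Φ` is a
primitive of a bounded function, and Lebesgue differentiation gives the classical equation almost
everywhere. The constants may blow up as `ε → 0`; only their finiteness is used. -/
lemma IsSolution.isStrongSolution {ε T K : ℝ} (hε : 0 < ε) (hT : 0 < T) {V W : ℝ → LInf}
    (hV : IsPotential T K V W) {Φ₀ : L2} {Φ : ℝ → L2} (hΦ : IsSolution ε T V Φ₀ Φ)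
    (hB : AssumptionB T Φ) : IsStrongSolution ε T V Φ := by
  obtain ⟨Φ', hw, heq⟩ := hΦ.equation
  obtain ⟨M, hM⟩ := isCompact_Icc.exists_bound_of_continuousOn hΦ.continuousOn
  obtain ⟨K', hK'⟩ := hB
  rw [ae_restrict_iff' measurableSet_Icc] at hK'
  rw [ae_restrict_iff' measurableSet_Ioo] at heq
  have heq' : ∀ᵐ s, s ∈ Ioo 0 T → ∃ g, IsDx (Φ s) g ∧ ‖g‖ ≤ K' ∧ Φ' s =
      -(Complex.I • ((1 / ε ^ 2 : ℝ) : ℂ) • diracT ε (Φ s) g) - Complex.I • mulL (V s) (Φ s) := by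
    filter_upwards [heq, hK'] with s h1 h2 hs
    obtain ⟨_, ⟨f₁, hf₁, rfl⟩, h3⟩ := h1 hs
    obtain ⟨g, hg, hgK⟩ := (h2 (Ioo_subset_Icc_self hs)).exists_isDx
    -- The derivative appearing in the equation and the one bounded by (B) are the same.
    have e : f₁ = g := hf₁.isDx.unique hg
    subst e
    refine ⟨f₁, hg, hgK, ?_⟩
    have h4 : Φ' s = (-Complex.I) • Complex.I • Φ' s := by
      rw [smul_smul]; simp
    have h6 : ∀ X Y : L2, (-Complex.I) • (X + Y) = -(Complex.I • X) - Complex.I • Y := by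
      intro X Y; module
    rw [h4, h3]
    exact h6 _ _
  set B : ℝ := 1 / ε ^ 2 * (ε * K' + M) + K * M
  have hbound : ∀ᵐ s, s ∈ Ioo 0 T → ‖Φ' s‖ ≤ B.toNNReal := by
    filter_upwards [heq', hV.bound] with s h1 h2 hs
    obtain ⟨g, -, hg2, h3⟩ := h1 hs
    have hMs := hM s (Ioo_subset_Icc_self hs)
    refine le_trans ?_ (Real.le_coe_toNNReal _)
    rw [h3]
    refine (norm_sub_le _ _).trans (add_le_add ?_ ?_)
    · rw [norm_neg, norm_smul, Complex.norm_I, one_mul, norm_smul, Complex.norm_real,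
        Real.norm_of_nonneg (by positivity)]
      refine mul_le_mul_of_nonneg_left ((norm_diracT_le hε.le _ _).trans ?_) (by positivity)
      gcongr
    · rw [norm_smul, Complex.norm_I, one_mul]
      exact (norm_mulL_le _ _).trans
        (mul_le_mul (h2 (Ioo_subset_Icc_self hs)).1 hMs (norm_nonneg _) hV.nonneg)
  have hmid : T / 2 ∈ Ioo 0 T := ⟨by linarith, by linarith⟩
  obtain ⟨c, hc⟩ := hw.exists_ae_eq ordConnected_Ioo isOpen_Ioo hmid hbound
  have hint : IntervalIntegrable Φ' volume 0 T := by
    rw [intervalIntegrable_iff_integrableOn_Ioo_of_le hT.le]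
    exact Integrable.of_bound (hw.2.1.aestronglyMeasurable) B.toNNReal
      ((ae_restrict_iff' measurableSet_Ioo).2 hbound)
  have hbound' : ∀ᵐ s, s ∈ uIcc 0 T → ‖Φ' s‖ ≤ B.toNNReal := by
    have h0 : ∀ᵐ x : ℝ, x ≠ 0 := by simp [ae_iff, measure_singleton]
    have hT' : ∀ᵐ x : ℝ, x ≠ T := by simp [ae_iff, measure_singleton]
    filter_upwards [hbound, h0, hT'] with s h1 h2 h3 hs
    rw [uIcc_of_le hT.le] at hs
    exact h1 ⟨lt_of_le_of_ne hs.1 h2.symm, lt_of_le_of_ne hs.2 h3⟩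
  set R : ℝ → L2 := fun t ↦ c + ∫ s in (T / 2)..t, Φ' s
  have hmid' : T / 2 ∈ uIcc 0 T := by rw [uIcc_of_le hT.le]; exact Ioo_subset_Icc_self hmid
  have hR : LipschitzOnWith B.toNNReal R (Icc 0 T) := by
    have h1 := lipschitzOnWith_intervalIntegral hint hmid' hbound'
    rw [uIcc_of_le hT.le] at h1
    refine LipschitzOnWith.of_dist_le_mul fun x hx y hy ↦ ?_
    have := h1.dist_le_mul x hx y hy
    rwa [← dist_add_left c] at this
  have heqR : ∀ t ∈ Icc 0 T, Φ t = R t := by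
    intro t ht
    have h1 := forall_mem_Icc_of_ae_le (B := 0) (f := fun t ↦ Φ t - R t) hT
      (hΦ.continuousOn.sub hR.continuousOn) (by
        have h0 : ∀ᵐ x : ℝ, x ≠ 0 := by simp [ae_iff, measure_singleton]
        have hT' : ∀ᵐ x : ℝ, x ≠ T := by simp [ae_iff, measure_singleton]
        filter_upwards [hc, h0, hT'] with s h1 h2 h3 hs
        rw [h1 ⟨lt_of_le_of_ne hs.1 h2.symm, lt_of_le_of_ne hs.2 h3⟩]
        simp [R]) t ht
    exact sub_eq_zero.1 (norm_le_zero_iff.1 h1)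
  refine ⟨⟨B.toNNReal, fun x hx y hy ↦ ?_⟩, ?_⟩
  · rw [heqR x hx, heqR y hy]
    exact hR hx hy
  · have h0 : ∀ᵐ x : ℝ, x ≠ 0 := by simp [ae_iff, measure_singleton]
    have hT' : ∀ᵐ x : ℝ, x ≠ T := by simp [ae_iff, measure_singleton]
    filter_upwards [heq', hint.ae_hasDerivAt_integral, h0, hT'] with s h1 h2 h3 h4 hs
    have hs' : s ∈ Ioo 0 T := ⟨lt_of_le_of_ne hs.1 h3.symm, lt_of_le_of_ne hs.2 h4⟩
    obtain ⟨g, hg, -, h5⟩ := h1 hs'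
    refine ⟨g, hg, ?_⟩
    rw [← h5]
    have h6 := (h2 (by rwa [uIcc_of_le hT.le]) (T / 2) hmid').const_add c
    refine h6.congr_of_eventuallyEq ?_
    filter_upwards [Icc_mem_nhds hs'.1 hs'.2] with x hx using heqR x hx

/-! ### Bounds that are uniform in `ε` -/

section Uniform

variable {ε T K : ℝ} {V W : ℝ → LInf} {Φ : ℝ → L2}

lemma IsStrongSolution.norm_le (hΦ : IsStrongSolution ε T V Φ) {t : ℝ} (ht : t ∈ Icc 0 T) :
    ‖Φ t‖ ≤ ‖Φ 0‖ := by
  obtain ⟨C, hC⟩ := hΦ.lipschitz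
  have h := norm_le_of_residual (ε := ε) (c := 1 / ε ^ 2) (B := 0) (V := V) hC (by
    filter_upwards [hΦ.equation] with s hs hs'
    obtain ⟨g, hg, hd⟩ := hs hs'
    exact ⟨g, 0, hg, by simp, by rwa [add_zero]⟩) ht
  simpa using h

lemma shift_smul_diracT (r ε : ℝ) (c d : ℂ) (f g : L2) :
    shift r (c • d • diracT ε f g) = c • d • diracT ε (shift r f) (shift r g) := by
  simp only [diracT, map_smul, map_add, shift_pauli1, shift_pauli3]

lemma diracT_sub (ε : ℝ) (f f' g g' : L2) :
    diracT ε (f - f') (g - g') = diracT ε f g - diracT ε f' g' := by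
  simp only [diracT, map_sub, smul_sub]
  abel

lemma IsDx.sub {f g f' g' : L2} (h : IsDx f g) (h' : IsDx f' g') : IsDx (f - f') (g - g') := by
  simpa [sub_eq_add_neg] using h.add (h'.smul (-1))

/-- The difference of the translated and the original solution satisfies the same equation with
source `(V(· + r) - V) Φ(· + r)`, whose norm is at most `K |r| ‖Φ 0‖`. -/
lemma IsStrongSolution.norm_shift_sub_le (hΦ : IsStrongSolution ε T V Φ)
    (hV : IsPotential T K V W) (r : ℝ) {t : ℝ} (ht : t ∈ Icc 0 T) :
    ‖shift r (Φ t) - Φ t‖ ≤ ‖shift r (Φ 0) - Φ 0‖ + K * |r| * ‖Φ 0‖ * t := by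
  obtain ⟨C, hC⟩ := hΦ.lipschitz
  have hlip : LipschitzOnWith (1 * C + C) (fun t ↦ shift r (Φ t) - Φ t) (Icc 0 T) :=
    ((shift r).lipschitz.comp_lipschitzOnWith hC).sub hC
  refine norm_le_of_residual (ε := ε) (c := 1 / ε ^ 2) (V := V) hlip ?_ ht
  filter_upwards [hΦ.equation, hV.bound] with s hs hb hs'
  obtain ⟨g, hg, hd⟩ := hs hs'
  obtain ⟨-, -, hb, -⟩ := hb hs'
  refine ⟨shift r g - g, -(Complex.I • mulL (shiftInf r (V s) - V s) (shift r (Φ s))),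
    (hg.shift r).sub hg, ?_, ?_⟩
  · rw [norm_neg, norm_smul, Complex.norm_I, one_mul]
    refine (norm_mulL_le _ _).trans ?_
    rw [LinearIsometry.norm_map]
    exact mul_le_mul (hb r) (hΦ.norm_le hs') (norm_nonneg _)
      (mul_nonneg hV.nonneg (abs_nonneg r))
  · have h1 : HasDerivAt (fun t ↦ shift r (Φ t)) (shift r (-(Complex.I •
        ((1 / ε ^ 2 : ℝ) : ℂ) • diracT ε (Φ s) g) - Complex.I • mulL (V s) (Φ s))) s :=
      ((shift r).toContinuousLinearMap.restrictScalars ℝ).hasFDerivAt.comp_hasDerivAt s hd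
    convert! h1.sub hd using 1
    rw [map_sub (shift r), map_neg (shift r), shift_smul_diracT, map_smul, shift_mulL, diracT_sub]
    simp only [map_sub, sub_apply]
    module

lemma IsStrongSolution.norm_deriv_le (hΦ : IsStrongSolution ε T V Φ)
    (hV : IsPotential T K V W) {K₀ : ℝ} (hK₀ : 0 ≤ K₀)
    (h0 : ∀ r, ‖shift r (Φ 0) - Φ 0‖ ≤ K₀ * |r|) {t : ℝ} (ht : t ∈ Icc 0 T) {g : L2}
    (hg : IsDx (Φ t) g) : ‖g‖ ≤ K₀ + K * ‖Φ 0‖ * T := by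
  have hK := hV.nonneg
  have hT := ht.1.trans ht.2
  refine hg.norm_le (by positivity) fun r ↦ (hΦ.norm_shift_sub_le hV r ht).trans ?_
  have h1 : K * |r| * ‖Φ 0‖ * t ≤ K * |r| * ‖Φ 0‖ * T :=
    mul_le_mul_of_nonneg_left ht.2 (by positivity)
  linarith [h0 r]

end Uniform

/-! ### The local error -/

/-- The potential cancels because `A' = -v`. The identity holds for every `α`, since its two
occurrences compensate each other; it is applied with `α = ∂ₓ A`, which makes the second argument of
`diracT` the true space derivative. -/
lemma hasDerivAt_twisted {ε c s : ℝ} {A : ℝ → LInf} {v α : LInf} {Φ : ℝ → L2} {g : L2}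
    (hA : HasDerivAt A (-v) s)
    (hΦ : HasDerivAt Φ (-(Complex.I • (c : ℂ) • diracT ε (Φ s) g) - Complex.I • mulL v (Φ s)) s) :
    HasDerivAt (fun r ↦ phaseL (A r) (Φ r))
      (-(Complex.I • (c : ℂ) • diracT ε (phaseL (A s) (Φ s))
        (phaseL (A s) g - Complex.I • mulL α (phaseL (A s) (Φ s)))) -
        (Complex.I * c * ε) • pauli1 (mulL α (phaseL (A s) (Φ s)))) s := by
  convert! HasDerivAt.phaseL hA hΦ using 1
  simp only [diracT, map_sub, map_neg, map_smul, map_add, phaseL_mulL, ← pauli1_phaseL,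
    ← pauli3_phaseL, neg_apply]
  match_scalars <;> ring_nf
  simp [Complex.I_pow_three]

/-- The residual of the corrected approximation. -/
def residual (ε : ℝ) (α γ γx γ' : LInf) (z z₁ : L2) : L2 :=
  -((Complex.I * (ε : ℂ)⁻¹) • pauli1 (mulL (α - γ) z)) - pauli3 (mulL γ z₁)
    - (1 / 2 : ℂ) • pauli3 (mulL γx z) + ((ε : ℂ) / 2) • pauli3 (pauli1 (mulL γ' z))
    - (Complex.I / 2) • pauli3 (mulL γ (mulL α z))

/-- The commutator of `-i ε⁻² σ₃` with `(ε/2) σ₃σ₁ γ` is `-(i/ε) σ₁ γ`, so only `α - γ` keeps the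
factor `1/ε`. The other residual terms come from commuting `σ₁ ∂ₓ` with the correction, from the
time derivative of `γ`, and from inserting `-(i/ε) σ₁ α z` into the correction. -/
lemma hasDerivAt_corrected {ε s : ℝ} (hε : ε ≠ 0) {γ : ℝ → LInf} {α γx γ' : LInf} {z : ℝ → L2}
    {z₁ : L2} (hγ : HasDerivAt γ γ' s)
    (hz : HasDerivAt z (-(Complex.I • ((1 / ε ^ 2 : ℝ) : ℂ) • diracT ε (z s) z₁) -
      (Complex.I * (1 / ε ^ 2 : ℝ) * ε) • pauli1 (mulL α (z s))) s) :
    HasDerivAt (fun r ↦ z r + ((ε : ℂ) / 2) • pauli3 (pauli1 (mulL (γ r) (z r))))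
      (-(Complex.I • ((1 / ε ^ 2 : ℝ) : ℂ) • diracT ε
        (z s + ((ε : ℂ) / 2) • pauli3 (pauli1 (mulL (γ s) (z s))))
        (z₁ + ((ε : ℂ) / 2) • pauli3 (pauli1 (mulL γx (z s) + mulL (γ s) z₁)))) +
        residual ε α (γ s) γx γ' (z s) z₁) s := by
  have h1 := HasDerivAt.mulL hγ hz
  have h2 := ((((ε : ℂ) / 2) • pauli3.comp pauli1).restrictScalars ℝ).hasFDerivAt.comp_hasDerivAt
    s h1
  convert! hz.add h2 using 1
  have hε' : (ε : ℂ) ≠ 0 := by exact_mod_cast hε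
  simp only [residual, diracT, map_sub, map_neg, map_smul, map_add, pauli1_mulL, pauli3_mulL,
    sub_apply, ContinuousLinearMap.coe_restrictScalars',
    smul_apply, ContinuousLinearMap.comp_apply, mulL_smul, pauli1_pauli3,
    pauli1_pauli1, pauli3_pauli3, mulL_comm (γ s) α]
  match_scalars <;> field_simp <;> ring_nf <;> simp [Complex.I_sq]
  all_goals try ring

lemma norm_five_le {E : Type*} [NormedAddCommGroup E] (x₁ x₂ x₃ x₄ x₅ : E) :
    ‖-x₁ - x₂ - x₃ + x₄ - x₅‖ ≤ ‖x₁‖ + ‖x₂‖ + ‖x₃‖ + ‖x₄‖ + ‖x₅‖ := by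
  have h1 := norm_sub_le (-x₁) x₂
  have h2 := norm_sub_le (-x₁ - x₂) x₃
  have h3 := norm_add_le (-x₁ - x₂ - x₃) x₄
  have h4 := norm_sub_le (-x₁ - x₂ - x₃ + x₄) x₅
  rw [norm_neg] at h1
  linarith

lemma norm_residual_le {ε : ℝ} (hε : 0 < ε) (α γ γx γ' : LInf) (z z₁ : L2) :
    ‖residual ε α γ γx γ' z z₁‖ ≤ ε⁻¹ * (‖α - γ‖ * ‖z‖) + ‖γ‖ * ‖z₁‖ + 1 / 2 * (‖γx‖ * ‖z‖)
      + ε / 2 * (‖γ'‖ * ‖z‖) + 1 / 2 * (‖γ‖ * (‖α‖ * ‖z‖)) := by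
  have h1 : ‖(Complex.I * (ε : ℂ)⁻¹) • pauli1 (mulL (α - γ) z)‖ ≤ ε⁻¹ * (‖α - γ‖ * ‖z‖) := by
    rw [norm_smul, norm_mul, Complex.norm_I, one_mul, norm_inv, Complex.norm_real,
      Real.norm_of_nonneg hε.le]
    gcongr
    exact (norm_pauli1_le _).trans (norm_mulL_le _ _)
  have h2 : ‖pauli3 (mulL γ z₁)‖ ≤ ‖γ‖ * ‖z₁‖ := (norm_pauli3_le _).trans (norm_mulL_le _ _)
  have h3 : ‖(1 / 2 : ℂ) • pauli3 (mulL γx z)‖ ≤ 1 / 2 * (‖γx‖ * ‖z‖) := by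
    rw [norm_smul, show ‖(1 / 2 : ℂ)‖ = 1 / 2 by simp]
    gcongr
    exact (norm_pauli3_le _).trans (norm_mulL_le _ _)
  have h4 : ‖((ε : ℂ) / 2) • pauli3 (pauli1 (mulL γ' z))‖ ≤ ε / 2 * (‖γ'‖ * ‖z‖) := by
    rw [norm_smul, show ‖(ε : ℂ) / 2‖ = ε / 2 by simp [abs_of_pos hε]]
    gcongr
    exact (norm_pauli3_le _).trans ((norm_pauli1_le _).trans (norm_mulL_le _ _))
  have h5 : ‖(Complex.I / 2) • pauli3 (mulL γ (mulL α z))‖ ≤ 1 / 2 * (‖γ‖ * (‖α‖ * ‖z‖)) := by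
    rw [norm_smul, show ‖Complex.I / 2‖ = 1 / 2 by simp]
    gcongr
    refine (norm_pauli3_le _).trans ((norm_mulL_le _ _).trans ?_)
    gcongr
    exact norm_mulL_le _ _
  refine (norm_five_le _ _ _ _ _).trans ?_
  gcongr

lemma LipschitzOnWith.phaseL {A : ℝ → LInf} {f : ℝ → L2} {C₁ C₂ M : ℝ≥0} {S : Set ℝ}
    (hA : LipschitzOnWith C₁ A S) (hf : LipschitzOnWith C₂ f S) (hM : ∀ s ∈ S, ‖f s‖ ≤ M) :
    LipschitzOnWith (C₁ * M + C₂) (fun s ↦ phaseL (A s) (f s)) S := by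
  refine LipschitzOnWith.of_dist_le_mul fun s hs r hr ↦ ?_
  have h1 := hA.dist_le_mul s hs r hr
  have h2 := hf.dist_le_mul s hs r hr
  rw [dist_eq_norm] at h1 h2 ⊢
  have e : DiracLie.phaseL (A s) (f s) - DiracLie.phaseL (A r) (f r) =
      (DiracLie.phaseL (A s) (f s) - DiracLie.phaseL (A r) (f s)) +
        DiracLie.phaseL (A r) (f s - f r) := by
    rw [map_sub]; abel
  rw [e, NNReal.coe_add, NNReal.coe_mul, add_mul]
  refine (norm_add_le _ _).trans (add_le_add ?_ (by rwa [LinearIsometry.norm_map]))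
  refine (norm_phaseL_sub_le _ _ _).trans ?_
  calc ‖A s - A r‖ * ‖f s‖ ≤ (C₁ * dist s r) * M := by gcongr; exact hM s hs
    _ = C₁ * M * dist s r := by ring

lemma LipschitzOnWith.mulL {A : ℝ → LInf} {f : ℝ → L2} {C₁ C₂ M N : ℝ≥0} {S : Set ℝ}
    (hA : LipschitzOnWith C₁ A S) (hf : LipschitzOnWith C₂ f S) (hM : ∀ s ∈ S, ‖f s‖ ≤ M)
    (hN : ∀ s ∈ S, ‖A s‖ ≤ N) :
    LipschitzOnWith (C₁ * M + N * C₂) (fun s ↦ mulL (A s) (f s)) S := by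
  refine LipschitzOnWith.of_dist_le_mul fun s hs r hr ↦ ?_
  have h1 := hA.dist_le_mul s hs r hr
  have h2 := hf.dist_le_mul s hs r hr
  rw [dist_eq_norm] at h1 h2 ⊢
  have e : DiracLie.mulL (A s) (f s) - DiracLie.mulL (A r) (f r) =
      DiracLie.mulL (A s - A r) (f s) + DiracLie.mulL (A r) (f s - f r) := by
    simp only [map_sub, sub_apply]; abel
  rw [e, NNReal.coe_add, NNReal.coe_mul, NNReal.coe_mul, add_mul]
  refine (norm_add_le _ _).trans (add_le_add ?_ ?_) <;> refine (norm_mulL_le _ _).trans ?_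
  · calc ‖A s - A r‖ * ‖f s‖ ≤ (C₁ * dist s r) * M := by gcongr; exact hM s hs
      _ = C₁ * M * dist s r := by ring
  · calc ‖A r‖ * ‖f s - f r‖ ≤ N * (C₂ * dist s r) := by gcongr; exact hN r hr
      _ = N * C₂ * dist s r := by ring

/-! ### Time regularity and difference quotients of the integrated potential. -/

section Potential

variable {T K : ℝ} {V W : ℝ → LInf}

lemma IsPotential.lipschitzOnWith (hV : IsPotential T K V W) {b : ℝ} (hb : b ∈ Icc 0 T) :
    LipschitzOnWith K.toNNReal (fun s ↦ ∫ r in s..b, V r) (Icc 0 T) := by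
  refine LipschitzOnWith.of_dist_le_mul fun s hs r hr ↦ ?_
  rw [dist_eq_norm, Real.coe_toNNReal _ hV.nonneg, ← intervalIntegral.integral_add_adjacent_intervals
    (hV.intervalIntegrable hs hr) (hV.intervalIntegrable hr hb), add_sub_cancel_right, dist_comm,
    Real.dist_eq]
  exact hV.norm_integral_le hs hr

/-- The difference quotient `δ⁻¹ (a(· + δ) - a)`. -/
def quotient (δ : ℝ) : LInf →L[ℝ] LInf :=
  δ⁻¹ • ((shiftInf δ).toContinuousLinearMap - ContinuousLinearMap.id ℝ LInf)

lemma quotient_apply (δ : ℝ) (a : LInf) : quotient δ a = δ⁻¹ • (shiftInf δ a - a) := rfl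

lemma norm_quotient_le {δ B : ℝ} (hδ : 0 < δ) {a : LInf} (h : ‖shiftInf δ a - a‖ ≤ δ * B) :
    ‖quotient δ a‖ ≤ B := by
  rw [quotient_apply, norm_smul, norm_inv, Real.norm_of_nonneg hδ.le, inv_mul_le_iff₀ hδ]
  exact h

/-- The reason for using quotients: applied to `∫ V`, they stay differentiable under translation in
`L^∞` norm, whereas `∫ W` is only known to be Lipschitz. -/
lemma hasDerivAt_shiftInf_quotient (δ : ℝ) {a a' : LInf}
    (h : HasDerivAt (fun h ↦ shiftInf h a) a' 0) :
    HasDerivAt (fun h ↦ shiftInf h (quotient δ a)) (quotient δ a') 0 := by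
  have h1 := (quotient δ).hasFDerivAt.comp_hasDerivAt (0 : ℝ) h
  convert! h1 using 1
  funext r
  simp only [Function.comp_apply, quotient_apply, map_smul, map_sub, shiftInf_shiftInf, add_comm]

end Potential

/-! ### The interaction picture and the local error of order `τ²/ε`. -/

section LocalError

variable {ε T K : ℝ} {V W : ℝ → LInf} {Φ : ℝ → L2}

/-- The solution in the interaction picture with respect to the potential. -/
def twisted (V : ℝ → LInf) (Φ : ℝ → L2) (b s : ℝ) : L2 := phaseL (∫ r in s..b, V r) (Φ s)

lemma twisted_self (V : ℝ → LInf) (Φ : ℝ → L2) (b : ℝ) : twisted V Φ b b = Φ b := by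
  rw [twisted, intervalIntegral.integral_same, phaseL_zero]

lemma norm_twisted_le (hΦ : IsStrongSolution ε T V Φ) {b s : ℝ} (hs : s ∈ Icc 0 T) :
    ‖twisted V Φ b s‖ ≤ ‖Φ 0‖ := by
  rw [twisted, LinearIsometry.norm_map]
  exact hΦ.norm_le hs

lemma exists_lipschitzOnWith_twisted (hΦ : IsStrongSolution ε T V Φ) (hV : IsPotential T K V W)
    {b : ℝ} (hb : b ∈ Icc 0 T) : ∃ C : ℝ≥0, LipschitzOnWith C (twisted V Φ b) (Icc 0 T) := by
  obtain ⟨C, hC⟩ := hΦ.lipschitz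
  exact ⟨_, LipschitzOnWith.phaseL (M := ‖Φ 0‖₊) (hV.lipschitzOnWith hb) hC fun s hs ↦
    hΦ.norm_le hs⟩

lemma ae_hasDerivAt_twisted (hT : 0 ≤ T) (hΦ : IsStrongSolution ε T V Φ)
    (hV : IsPotential T K V W) {K₁ : ℝ}
    (hK₁ : ∀ s ∈ Icc 0 T, ∀ g, IsDx (Φ s) g → ‖g‖ ≤ K₁) {b : ℝ} (hb : b ∈ Icc 0 T) :
    ∀ᵐ s, s ∈ Icc 0 T → ∃ z₁, IsDx (twisted V Φ b s) z₁ ∧ ‖z₁‖ ≤ K₁ + K * T * ‖Φ 0‖ ∧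
      HasDerivAt (twisted V Φ b)
        (-(Complex.I • ((1 / ε ^ 2 : ℝ) : ℂ) • diracT ε (twisted V Φ b s) z₁) -
        (Complex.I * (1 / ε ^ 2 : ℝ) * ε) •
          pauli1 (mulL (∫ r in s..b, W r) (twisted V Φ b s))) s := by
  filter_upwards [hΦ.equation, hV.ae_hasDerivAt_integral hT] with s h1 h2 hs
  obtain ⟨g, hg, hd⟩ := h1 hs
  refine ⟨_, IsDx.phaseL (hV.hasDerivAt_shiftInf_integral hs hb) hg, ?_,
    hasDerivAt_twisted (h2 hs b hb) hd⟩
  refine (norm_sub_le _ _).trans (add_le_add ?_ ?_)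
  · rw [LinearIsometry.norm_map]; exact hK₁ s hs g hg
  · rw [norm_smul, Complex.norm_I, one_mul]
    refine (norm_mulL_le _ _).trans ?_
    have h3 := hV.norm_integral_deriv_le hs hb
    have h4 : |b - s| ≤ T := abs_le.2 ⟨by linarith [hs.2, hb.1], by linarith [hs.1, hb.2]⟩
    rw [LinearIsometry.norm_map]
    exact mul_le_mul (h3.trans (mul_le_mul_of_nonneg_left h4 hV.nonneg)) (hΦ.norm_le hs)
      (norm_nonneg _) (mul_nonneg hV.nonneg hT)

/-- Here the whole commutator is treated as residual. One factor `b - a` comes from `∂ₓ ∫_s^b V`,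
the other from integration in time. -/
lemma norm_twisted_sub_flowL_le (hε : 0 < ε) (hΦ : IsStrongSolution ε T V Φ)
    (hV : IsPotential T K V W) {K₁ : ℝ}
    (hK₁ : ∀ s ∈ Icc 0 T, ∀ g, IsDx (Φ s) g → ‖g‖ ≤ K₁) {a b : ℝ} (ha : 0 ≤ a) (hab : a < b)
    (hb : b ≤ T) :
    ‖Φ b - flowL ε (1 / ε ^ 2 * (b - a)) (twisted V Φ b a)‖ ≤
      K * ‖Φ 0‖ * (b - a) * ((b - a) / ε) := by
  have hb' : b ∈ Icc 0 T := ⟨ha.trans hab.le, hb⟩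
  have hsub : Icc a b ⊆ Icc 0 T := Icc_subset_Icc ha hb
  have hT := hb'.1.trans hb'.2
  obtain ⟨C, hC⟩ := exists_lipschitzOnWith_twisted hΦ hV hb'
  have h := norm_sub_flowL_le (ε := ε) (c := 1 / ε ^ 2) (B := 1 / ε * (K * (b - a) * ‖Φ 0‖))
    (L := ε * (K₁ + K * T * ‖Φ 0‖) + ‖Φ 0‖) hab (hC.mono hsub) (by
      filter_upwards [ae_hasDerivAt_twisted hT hΦ hV hK₁ hb'] with s hs hs'
      obtain ⟨z₁, hz, hz₁, hd⟩ := hs (hsub hs')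
      refine ⟨z₁, -((Complex.I * (1 / ε ^ 2 : ℝ) * ε) •
          pauli1 (mulL (∫ r in s..b, W r) (twisted V Φ b s))), hz, ?_, ?_, ?_⟩
      · refine (norm_diracT_le hε.le _ _).trans ?_
        gcongr
        exact norm_twisted_le hΦ (hsub hs')
      · rw [norm_neg, norm_smul]
        have e : ‖Complex.I * ((1 / ε ^ 2 : ℝ) : ℂ) * (ε : ℂ)‖ = 1 / ε := by
          rw [norm_mul, norm_mul, Complex.norm_I, Complex.norm_real, Complex.norm_real,
            Real.norm_of_nonneg hε.le, Real.norm_of_nonneg (by positivity)]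
          field_simp
        rw [e]
        refine mul_le_mul_of_nonneg_left ?_ (by positivity)
        refine (norm_pauli1_le _).trans ((norm_mulL_le _ _).trans ?_)
        have h3 := hV.norm_integral_deriv_le (hsub hs') hb'
        have h4 : |b - s| ≤ b - a := abs_le.2 ⟨by linarith [hs'.2], by linarith [hs'.1]⟩
        exact mul_le_mul (h3.trans (mul_le_mul_of_nonneg_left h4 hV.nonneg))
          (norm_twisted_le hΦ (hsub hs')) (norm_nonneg _)
          (mul_nonneg hV.nonneg (sub_nonneg.2 hab.le))
      · rwa [← sub_eq_add_neg])
  rw [twisted_self] at h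
  refine h.trans (le_of_eq ?_)
  ring

end LocalError

/-! ### The normal form and the local error of order `τ(τ + ε)`. -/

section Corrected

variable {ε T K : ℝ} {V W : ℝ → LInf} {Φ : ℝ → L2}

/-- The solution in the interaction picture, corrected so that the term of order `1 / ε` in the
equation disappears. -/
def corrected (ε : ℝ) (V : ℝ → LInf) (Φ : ℝ → L2) (b s : ℝ) : L2 :=
  twisted V Φ b s + ((ε : ℂ) / 2) •
    pauli3 (pauli1 (mulL (quotient (ε ^ 2) (∫ r in s..b, V r)) (twisted V Φ b s)))

lemma corrected_self (ε : ℝ) (V : ℝ → LInf) (Φ : ℝ → L2) (b : ℝ) :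
    corrected ε V Φ b b = Φ b := by
  rw [corrected, twisted_self, intervalIntegral.integral_same]
  simp

lemma exists_lipschitzOnWith_corrected (hΦ : IsStrongSolution ε T V Φ)
    (hV : IsPotential T K V W) {b : ℝ} (hb : b ∈ Icc 0 T) :
    ∃ C : ℝ≥0, LipschitzOnWith C (corrected ε V Φ b) (Icc 0 T) := by
  obtain ⟨C, hC⟩ := exists_lipschitzOnWith_twisted hΦ hV hb
  have h1 := (quotient (ε ^ 2)).lipschitz.comp_lipschitzOnWith (hV.lipschitzOnWith hb)
  obtain ⟨N, hN⟩ := isCompact_Icc.exists_bound_of_continuousOn h1.continuousOn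
  have h2 := LipschitzOnWith.mulL (M := ‖Φ 0‖₊) (N := N.toNNReal) h1 hC
    (fun s hs ↦ norm_twisted_le hΦ hs) (fun s hs ↦ (hN s hs).trans (Real.le_coe_toNNReal _))
  exact ⟨_, hC.add ((((ε : ℂ) / 2) • pauli3.comp pauli1).lipschitz.comp_lipschitzOnWith h2)⟩

lemma norm_quotient_integral_le (hε : 0 < ε) (hV : IsPotential T K V W) {s b : ℝ}
    (hs : s ∈ Icc 0 T) (hb : b ∈ Icc 0 T) :
    ‖quotient (ε ^ 2) (∫ r in s..b, V r)‖ ≤ K * |b - s| := by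
  refine norm_quotient_le (by positivity) ((hV.norm_shiftInf_integral_sub_le hs hb _).trans ?_)
  rw [abs_of_pos (by positivity : 0 < ε ^ 2)]
  exact le_of_eq (by ring)

lemma norm_quotient_integral_deriv_le (hε : 0 < ε) (hV : IsPotential T K V W) {s b : ℝ}
    (hs : s ∈ Icc 0 T) (hb : b ∈ Icc 0 T) :
    ‖quotient (ε ^ 2) (∫ r in s..b, W r)‖ ≤ K * |b - s| := by
  refine norm_quotient_le (by positivity)
    ((hV.norm_shiftInf_integral_deriv_sub_le hs hb _).trans ?_)
  rw [abs_of_pos (by positivity : 0 < ε ^ 2)]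
  exact le_of_eq (by ring)

/-- The step `ε²` makes the error of replacing `α` by the quotient small enough to absorb the factor
`1/ε` in the residual: what remains is `O(ετ)`. -/
lemma norm_integral_deriv_sub_quotient_le (hε : 0 < ε) (hV : IsPotential T K V W) {s b : ℝ}
    (hs : s ∈ Icc 0 T) (hb : b ∈ Icc 0 T) :
    ‖(∫ r in s..b, W r) - quotient (ε ^ 2) (∫ r in s..b, V r)‖ ≤ ε ^ 2 * (K * |b - s|) := by
  have hδ : 0 < ε ^ 2 := by positivity
  have h := hV.norm_shiftInf_integral_sub_sub_le hs hb (ε ^ 2)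
  set A := ∫ r in s..b, V r
  set α := ∫ r in s..b, W r
  have e : α - quotient (ε ^ 2) A = -((ε ^ 2)⁻¹ • (shiftInf (ε ^ 2) A - A - ε ^ 2 • α)) := by
    rw [quotient_apply, smul_sub _ _ (ε ^ 2 • α), smul_smul, inv_mul_cancel₀ hδ.ne', one_smul]
    abel
  rw [e, norm_neg, norm_smul, norm_inv, Real.norm_of_nonneg hδ.le, inv_mul_le_iff₀ hδ]
  exact h.trans (le_of_eq (by ring))

lemma norm_diracT_corrected_le (hε : 0 < ε) (hε1 : ε ≤ 1) {γ γx : LInf} {z z₁ : L2}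
    {M N Z : ℝ} (hN : 0 ≤ N) (hz : ‖z‖ ≤ M) (hz₁ : ‖z₁‖ ≤ Z) (hγ : ‖γ‖ ≤ N) (hγx : ‖γx‖ ≤ N) :
    ‖diracT ε (z + ((ε : ℂ) / 2) • pauli3 (pauli1 (mulL γ z)))
      (z₁ + ((ε : ℂ) / 2) • pauli3 (pauli1 (mulL γx z + mulL γ z₁)))‖ ≤
      (Z + (N * M + N * Z)) + (M + N * M) := by
  have h0 : ∀ f : L2, ‖((ε : ℂ) / 2) • pauli3 (pauli1 f)‖ ≤ ‖f‖ := by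
    intro f
    rw [norm_smul, show ‖(ε : ℂ) / 2‖ = ε / 2 by simp [abs_of_pos hε]]
    calc ε / 2 * ‖pauli3 (pauli1 f)‖ ≤ 1 * ‖f‖ := by
          gcongr
          · linarith
          · exact (norm_pauli3_le _).trans (norm_pauli1_le _)
      _ = ‖f‖ := one_mul _
  have hm : ∀ {a : LInf} {f : L2} {F : ℝ}, ‖a‖ ≤ N → ‖f‖ ≤ F → ‖mulL a f‖ ≤ N * F :=
    fun ha hf ↦ (norm_mulL_le _ _).trans (mul_le_mul ha hf (norm_nonneg _) hN)
  refine (norm_diracT_le hε.le _ _).trans (add_le_add ?_ ?_)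
  · refine (mul_le_of_le_one_left (norm_nonneg _) hε1).trans ((norm_add_le _ _).trans ?_)
    exact add_le_add hz₁ ((h0 _).trans ((norm_add_le _ _).trans
      (add_le_add (hm hγx hz) (hm hγ hz₁))))
  · exact (norm_add_le _ _).trans (add_le_add hz ((h0 _).trans (hm hγ hz)))

/-- The term with `ε / 2` comes from the time derivative of `γ`, which is bounded but not small in
`τ`. Each of the others carries a factor `τ`. -/
lemma residual_bound_le {ε K M Z T τ : ℝ} (hε : 0 < ε) (hε1 : ε ≤ 1) (hK : 0 ≤ K) (hM : 0 ≤ M)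
    (hZ : 0 ≤ Z) (hτ : 0 ≤ τ) (hτT : τ ≤ T) :
    ε⁻¹ * (ε ^ 2 * (K * τ) * M) + K * τ * Z + 1 / 2 * (K * τ * M) + ε / 2 * (K * M) +
      1 / 2 * (K * τ * (K * τ * M)) ≤ (2 * K * M + K * Z + K ^ 2 * T * M) * (τ + ε) := by
  have e : ε⁻¹ * (ε ^ 2 * (K * τ) * M) = ε * (K * M * τ) := by field_simp
  have h1 : ε * (K * M * τ) ≤ 1 * (K * M * τ) := by gcongr
  have h2 : K ^ 2 * M * τ * τ ≤ K ^ 2 * M * τ * T := by gcongr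
  have h3 : 0 ≤ K * M * τ := by positivity
  have h4 : 0 ≤ K * M * ε := by positivity
  have h5 : 0 ≤ K * Z * ε := by positivity
  have h6 : 0 ≤ K ^ 2 * M * τ * T := mul_nonneg (by positivity) (hτ.trans hτT)
  have h7 : 0 ≤ K ^ 2 * M * ε * T := mul_nonneg (by positivity) (hτ.trans hτT)
  rw [e]
  nlinarith

lemma norm_corrected_sub_flowL_le (hε : 0 < ε) (hε1 : ε ≤ 1) (hΦ : IsStrongSolution ε T V Φ)
    (hV : IsPotential T K V W) {K₁ : ℝ} (hK₁0 : 0 ≤ K₁)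
    (hK₁ : ∀ s ∈ Icc 0 T, ∀ g, IsDx (Φ s) g → ‖g‖ ≤ K₁) {a b : ℝ} (ha : 0 ≤ a) (hab : a < b)
    (hb : b ≤ T) :
    ‖Φ b - flowL ε (1 / ε ^ 2 * (b - a)) (corrected ε V Φ b a)‖ ≤
      (2 * K * ‖Φ 0‖ + K * (K₁ + K * T * ‖Φ 0‖) + K ^ 2 * T * ‖Φ 0‖) * ((b - a) + ε) *
        (b - a) := by
  have hb' : b ∈ Icc 0 T := ⟨ha.trans hab.le, hb⟩
  have hsub : Icc a b ⊆ Icc 0 T := Icc_subset_Icc ha hb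
  have hT := hb'.1.trans hb'.2
  have hK := hV.nonneg
  set Z := K₁ + K * T * ‖Φ 0‖ with hZ
  have hZ0 : 0 ≤ Z := by positivity
  set N := K * (b - a) with hN
  have hN0 : 0 ≤ N := mul_nonneg hK (sub_nonneg.2 hab.le)
  obtain ⟨C, hC⟩ := exists_lipschitzOnWith_corrected hΦ hV hb'
  have h := norm_sub_flowL_le (ε := ε) (c := 1 / ε ^ 2)
    (B := (2 * K * ‖Φ 0‖ + K * Z + K ^ 2 * T * ‖Φ 0‖) * ((b - a) + ε))
    (L := (Z + (N * ‖Φ 0‖ + N * Z)) + (‖Φ 0‖ + N * ‖Φ 0‖)) hab (hC.mono hsub) (by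
      filter_upwards [ae_hasDerivAt_twisted hT hΦ hV hK₁ hb', hV.ae_hasDerivAt_integral hT,
        hV.bound] with s hs hA hbd hs'
      have hsT := hsub hs'
      obtain ⟨z₁, hz, hz₁, hd⟩ := hs hsT
      have hN' : K * |b - s| ≤ N := by
        have h4 : |b - s| ≤ b - a := abs_le.2 ⟨by linarith [hs'.2], by linarith [hs'.1]⟩
        exact mul_le_mul_of_nonneg_left h4 hK
      have hα := (hV.norm_integral_deriv_le hsT hb').trans hN'
      have hγ := (norm_quotient_integral_le hε hV hsT hb').trans hN'
      have hγx := (norm_quotient_integral_deriv_le hε hV hsT hb').trans hN'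
      have hαγ := (norm_integral_deriv_sub_quotient_le hε hV hsT hb').trans
        (mul_le_mul_of_nonneg_left hN' (sq_nonneg ε))
      have hγ' : ‖quotient (ε ^ 2) (-(V s))‖ ≤ K := by
        rw [map_neg, norm_neg]
        refine norm_quotient_le (by positivity) (((hbd hsT).2.2.1 _).trans ?_)
        rw [abs_of_pos (by positivity : 0 < ε ^ 2), mul_comm]
      have hM := norm_twisted_le (b := b) hΦ hsT
      have hγd := (quotient (ε ^ 2)).hasFDerivAt.comp_hasDerivAt s (hA hsT b hb')
      have hmul := IsDx.mulL
        (hasDerivAt_shiftInf_quotient (ε ^ 2) (hV.hasDerivAt_shiftInf_integral hsT hb')) hz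
      refine ⟨_, _, hz.add (hmul.pauli1.pauli3.smul _), ?_, ?_,
        hasDerivAt_corrected hε.ne' hγd hd⟩
      · exact norm_diracT_corrected_le hε hε1 hN0 hM hz₁ hγ hγx
      · refine (norm_residual_le hε _ _ _ _ _ _).trans (le_trans ?_
          (residual_bound_le hε hε1 hK (norm_nonneg (Φ 0)) hZ0 (sub_nonneg.2 hab.le)
            (by linarith : b - a ≤ T)))
        gcongr)
  -- At the right end the integral of `V` is empty, so the correction vanishes there.
  rwa [corrected_self] at h

lemma norm_sub_flowL_twisted_le (hε : 0 < ε) (hε1 : ε ≤ 1) (hΦ : IsStrongSolution ε T V Φ)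
    (hV : IsPotential T K V W) {K₁ : ℝ} (hK₁0 : 0 ≤ K₁)
    (hK₁ : ∀ s ∈ Icc 0 T, ∀ g, IsDx (Φ s) g → ‖g‖ ≤ K₁) {a b : ℝ} (ha : 0 ≤ a) (hab : a < b)
    (hb : b ≤ T) :
    ‖Φ b - flowL ε (1 / ε ^ 2 * (b - a)) (twisted V Φ b a)‖ ≤
      (3 * K * ‖Φ 0‖ + K * (K₁ + K * T * ‖Φ 0‖) + K ^ 2 * T * ‖Φ 0‖) * ((b - a) + ε) *
        (b - a) := by
  have h1 := norm_corrected_sub_flowL_le hε hε1 hΦ hV hK₁0 hK₁ ha hab hb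
  have hK := hV.nonneg
  have haT : a ∈ Icc 0 T := ⟨ha, hab.le.trans hb⟩
  have hbT : b ∈ Icc 0 T := ⟨ha.trans hab.le, hb⟩
  have hτ : 0 < b - a := sub_pos.2 hab
  set η := ((ε : ℂ) / 2) • pauli3 (pauli1 (mulL (quotient (ε ^ 2) (∫ r in a..b, V r))
    (twisted V Φ b a))) with hη
  have h2 : ‖η‖ ≤ ε * (K * (b - a) * ‖Φ 0‖) := by
    rw [hη, norm_smul, show ‖(ε : ℂ) / 2‖ = ε / 2 by simp [abs_of_pos hε]]
    have h3 := norm_quotient_integral_le hε hV haT hbT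
    rw [abs_of_pos hτ] at h3
    gcongr
    · linarith
    · refine (norm_pauli3_le _).trans ((norm_pauli1_le _).trans ((norm_mulL_le _ _).trans ?_))
      gcongr
      exact norm_twisted_le hΦ haT
  have e : Φ b - flowL ε (1 / ε ^ 2 * (b - a)) (twisted V Φ b a) =
      (Φ b - flowL ε (1 / ε ^ 2 * (b - a)) (corrected ε V Φ b a)) +
        flowL ε (1 / ε ^ 2 * (b - a)) η := by
    rw [corrected, ← hη, map_add]
    abel
  rw [e]
  refine (norm_add_le _ _).trans ?_
  rw [LinearIsometry.norm_map]
  -- Removing the correction at the left end costs `ε K ‖Φ 0‖ (b - a)`, which raises the coefficient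
  -- `2` to `3`. This inequality enlarges `ε` to `(b - a) + ε`.
  have h4 : 0 ≤ K * ‖Φ 0‖ * (b - a) * (b - a) := by positivity
  nlinarith

end Corrected

/-! ### The global error -/

lemma norm_lieTrotter_sub_le {ε τ T B : ℝ} {V : ℝ → LInf} {Φ : ℝ → L2} (hτ : 0 < τ)
    (h : ∀ a b, 0 ≤ a → a < b → b ≤ T → b - a = τ →
      ‖Φ b - flowL ε (1 / ε ^ 2 * (b - a)) (twisted V Φ b a)‖ ≤ B * τ)
    (n : ℕ) (hn : n * τ ≤ T) : ‖Φ (n * τ) - lieTrotter ε τ V (Φ 0) n‖ ≤ B * (n * τ) := by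
  induction n with
  | zero => simp [lieTrotter]
  | succ n ih =>
    push_cast at hn ⊢
    have h1 := ih (by nlinarith)
    have h2 := h (n * τ) ((n + 1) * τ) (by positivity) (by nlinarith) hn (by ring)
    -- Local error plus propagated error: one step of the scheme is linear and isometric, so the old
    -- error is carried along without growth.
    have e : Φ ((n + 1) * τ) - lieTrotter ε τ V (Φ 0) (n + 1) =
        (Φ ((n + 1) * τ) - flowL ε (1 / ε ^ 2 * ((n + 1) * τ - n * τ))
          (twisted V Φ ((n + 1) * τ) (n * τ))) +
        flowL ε (τ / ε ^ 2) (phaseL (∫ s in (n * τ)..((n + 1) * τ), V s)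
          (Φ (n * τ) - lieTrotter ε τ V (Φ 0) n)) := by
      have e1 : 1 / ε ^ 2 * ((n + 1) * τ - n * τ) = τ / ε ^ 2 := by ring
      rw [e1, map_sub, map_sub, lieTrotter, twisted, ← phaseL_apply, ← flowL_apply]
      abel
    rw [e]
    refine (norm_add_le _ _).trans ?_
    rw [LinearIsometry.norm_map, LinearIsometry.norm_map]
    linarith

lemma AssumptionB.exists_norm_shift_sub_le {T : ℝ} (hT : 0 < T) {Φ : ℝ → L2}
    (hc : ContinuousOn Φ (Icc 0 T)) (hB : AssumptionB T Φ) :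
    ∃ K₀, 0 ≤ K₀ ∧ ∀ r, ‖shift r (Φ 0) - Φ 0‖ ≤ K₀ * |r| := by
  obtain ⟨K, hK⟩ := hB
  rw [ae_restrict_iff' measurableSet_Icc] at hK
  refine ⟨|K|, abs_nonneg K, fun r ↦ ?_⟩
  refine forall_mem_Icc_of_ae_le (f := fun t ↦ shift r (Φ t) - Φ t) hT
    (((shift r).continuous.comp_continuousOn hc).sub hc) ?_ 0 ⟨le_rfl, hT.le⟩
  filter_upwards [hK] with s hs hs'
  obtain ⟨g, hg, hgK⟩ := (hs hs').exists_isDx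
  exact (hg.norm_shift_sub_le r).trans
    (mul_le_mul_of_nonneg_right (hgK.trans (le_abs_self K)) (abs_nonneg r))

lemma min_div_le_sqrt {δ τ : ℝ} (hδ : 0 < δ) (hτ : 0 ≤ τ) : min δ (τ / δ) ≤ √τ := by
  rcases le_total δ (√τ) with h | h
  · exact (min_le_left _ _).trans h
  · refine (min_le_right _ _).trans ?_
    rw [div_le_iff₀ hδ]
    nlinarith [Real.mul_self_sqrt hτ, Real.sqrt_nonneg τ]

/-- The two branches cross at `δ = √τ`. If this exceeds `1`, the branch `δ` is the smaller one on
all of `(0, 1]` and the maximum sits at `δ = 1`. -/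
lemma isGreatest_min_div {τ : ℝ} (hτ : 0 < τ) :
    IsGreatest ((fun δ : ℝ ↦ min δ (τ / δ)) '' Ioc 0 1) (min 1 √τ) := by
  refine ⟨?_, ?_⟩
  · rcases le_total τ 1 with h | h
    · have h1 : √τ ≤ 1 := Real.sqrt_le_one.2 h
      refine ⟨√τ, ⟨Real.sqrt_pos.2 hτ, h1⟩, ?_⟩
      simp [h1]
    · refine ⟨1, ⟨one_pos, le_rfl⟩, ?_⟩
      have h1 : 1 ≤ √τ := Real.one_le_sqrt.2 h
      simp [h, h1]
  · rintro _ ⟨δ, ⟨h0, h1⟩, rfl⟩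
    exact le_min ((min_le_left _ _).trans h1) (min_div_le_sqrt h0 hτ.le)

lemma exists_norm_lieTrotter_sub_le {T : ℝ} (hT : 0 < T) {V : ℝ → LInf} (hA : AssumptionA T V)
    (Φ₀ : L2) : ∃ E : ℝ, 0 ≤ E ∧ ∀ ε : ℝ, 0 < ε → ε ≤ 1 → ∀ Φ : ℝ → L2, IsSolution ε T V Φ₀ Φ →
      AssumptionB T Φ → ∀ τ : ℝ, 0 < τ → ∀ n : ℕ, n * τ ≤ T →
        ‖Φ (n * τ) - lieTrotter ε τ V Φ₀ n‖ ≤ E * (τ + ε) ∧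
        ‖Φ (n * τ) - lieTrotter ε τ V Φ₀ n‖ ≤ E * (τ / ε) := by
  obtain ⟨K, W, hV⟩ := hA.exists_isPotential hT
  have hK := hV.nonneg
  -- The constant must be fixed before `ε` and `Φ`, so the translation bound is asked of `Φ₀` alone.
  -- If it fails, no solution with this datum satisfies (B), and any constant will do.
  by_cases h0 : ∃ K₀, 0 ≤ K₀ ∧ ∀ r, ‖shift r Φ₀ - Φ₀‖ ≤ K₀ * |r|
  · obtain ⟨K₀, hK₀, h0⟩ := h0
    set K₁ := K₀ + K * ‖Φ₀‖ * T
    have hK₁0 : 0 ≤ K₁ := by positivity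
    set D := 3 * K * ‖Φ₀‖ + K * (K₁ + K * T * ‖Φ₀‖) + K ^ 2 * T * ‖Φ₀‖
    have hD : 0 ≤ D := by positivity
    refine ⟨(D + K * ‖Φ₀‖) * T, by positivity, fun ε hε hε1 Φ hΦ hB τ hτ n hn ↦ ?_⟩
    have hs := hΦ.isStrongSolution hε hT hV hB
    obtain rfl := hΦ.initial
    have hK₁ : ∀ s ∈ Icc 0 T, ∀ g, IsDx (Φ s) g → ‖g‖ ≤ K₁ :=
      fun s hs' g hg ↦ hs.norm_deriv_le hV hK₀ h0 hs' hg
    have h1 := norm_lieTrotter_sub_le (B := D * (τ + ε)) hτ (fun a b ha hab hb e ↦ by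
      have := norm_sub_flowL_twisted_le hε hε1 hs hV hK₁0 hK₁ ha hab hb
      rwa [e] at this ⊢) n hn
    have h2 := norm_lieTrotter_sub_le (B := K * ‖Φ 0‖ * (τ / ε)) hτ (fun a b ha hab hb e ↦ by
      have := norm_twisted_sub_flowL_le hε hs hV hK₁ ha hab hb
      rw [e] at this ⊢
      exact this.trans (le_of_eq (by ring))) n hn
    constructor
    · refine h1.trans ?_
      calc D * (τ + ε) * (n * τ) ≤ (D + K * ‖Φ 0‖) * (τ + ε) * T := by
            gcongr
            exact le_add_of_nonneg_right (by positivity)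
        _ = _ := by ring
    · refine h2.trans ?_
      calc K * ‖Φ 0‖ * (τ / ε) * (n * τ) ≤ (D + K * ‖Φ 0‖) * (τ / ε) * T := by
            gcongr
            exact le_add_of_nonneg_left hD
        _ = _ := by ring
  · refine ⟨0, le_rfl, fun ε hε hε1 Φ hΦ hB ↦ absurd ?_ h0⟩
    have := hB.exists_norm_shift_sub_le hT hΦ.continuousOn
    rwa [hΦ.initial] at this

end DiracLie

end

theorem theorem2p1 (T : ℝ) (hT : 0 < T) (V : ℝ → DiracLie.LInf)
    (hA : DiracLie.AssumptionA T V) (Φ₀ : DiracLie.L2) :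
    ∃ C : ℝ, 0 < C ∧
      ∀ ε : ℝ, 0 < ε → ε ≤ 1 →
      ∀ Φ : ℝ → DiracLie.L2, DiracLie.IsSolution ε T V Φ₀ Φ → DiracLie.AssumptionB T Φ →
      ∀ τ : ℝ, 0 < τ → ∀ n : ℕ, n * τ ≤ T →
        ‖Φ (n * τ) - DiracLie.lieTrotter ε τ V Φ₀ n‖ ≤ C * (τ + ε) ∧
        ‖Φ (n * τ) - DiracLie.lieTrotter ε τ V Φ₀ n‖ ≤ C * (τ + τ / ε) ∧
        (∃ M : ℝ, IsGreatest ((fun δ : ℝ ↦ min δ (τ / δ)) '' Set.Ioc 0 1) M ∧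
          ‖Φ (n * τ) - DiracLie.lieTrotter ε τ V Φ₀ n‖ ≤ C * (τ + M) ∧
          (τ ≤ T → τ + M ≤ C * Real.sqrt τ)) ∧
        ‖Φ (n * τ) - DiracLie.lieTrotter ε τ V Φ₀ n‖ ≤ C * Real.sqrt τ := by
  obtain ⟨E, hE, h⟩ := DiracLie.exists_norm_lieTrotter_sub_le hT hA Φ₀
  have hsT := Real.sqrt_nonneg T
  have hC1 : E ≤ (E + 1) * (Real.sqrt T + 1) := by nlinarith
  have hC2 : Real.sqrt T + 1 ≤ (E + 1) * (Real.sqrt T + 1) := by nlinarith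
  -- The factor `√T + 1` comes from `τ + √τ ≤ (√T + 1) √τ` for `τ ≤ T`. Using `E + 1` keeps the
  -- constant positive and at least `√T + 1`.
  refine ⟨(E + 1) * (Real.sqrt T + 1), by positivity, fun ε hε hε1 Φ hΦ hB τ hτ n hn ↦ ?_⟩
  obtain ⟨h1, h2⟩ := h ε hε hε1 Φ hΦ hB τ hτ n hn
  have hmax := DiracLie.isGreatest_min_div hτ
  -- The actual `ε` is one of the competitors `δ` in the maximum.
  have hM : min ε (τ / ε) ≤ min 1 (Real.sqrt τ) := hmax.2 ⟨ε, ⟨hε, hε1⟩, rfl⟩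
  have hmin : ‖Φ (n * τ) - DiracLie.lieTrotter ε τ V Φ₀ n‖ ≤ E * (τ + min ε (τ / ε)) := by
    rcases min_cases ε (τ / ε) with h3 | h3
    · rwa [h3.1]
    · rw [h3.1]
      refine h2.trans ?_
      gcongr
      linarith
  have h3 := hmin.trans (mul_le_mul_of_nonneg_left (add_le_add_right hM τ) hE)
  have hsum : τ ≤ T → τ + min 1 (Real.sqrt τ) ≤ (Real.sqrt T + 1) * Real.sqrt τ := by
    intro hτT
    have h4 : Real.sqrt τ * Real.sqrt τ ≤ Real.sqrt T * Real.sqrt τ :=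
      mul_le_mul_of_nonneg_right (Real.sqrt_le_sqrt hτT) (Real.sqrt_nonneg τ)
    rw [Real.mul_self_sqrt hτ.le] at h4
    linarith [min_le_right 1 (Real.sqrt τ)]
  have hpos : 0 ≤ τ + min 1 (Real.sqrt τ) := by positivity
  refine ⟨h1.trans (by gcongr), h2.trans ?_, ⟨_, hmax, h3.trans (by gcongr), fun hτT ↦
    (hsum hτT).trans (by gcongr)⟩, ?_⟩
  · exact mul_le_mul hC1 (by linarith) (by positivity) (by positivity)
  · rcases Nat.eq_zero_or_pos n with rfl | hn0
    · simp only [Nat.cast_zero, zero_mul, DiracLie.lieTrotter, hΦ.initial, sub_self, norm_zero]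
      positivity
    · have h5 : (1 : ℝ) ≤ n := by exact_mod_cast hn0
      have hτT : τ ≤ T := le_trans (by nlinarith) hn
      refine h3.trans ((mul_le_mul_of_nonneg_left (hsum hτT) hE).trans ?_)
      rw [← mul_assoc]
      gcongr
      linarith
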